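/- **Setting.** In a congestion game on integral polymatroids there are a non-empty finite set $N$ of players and a non-empty finite set $R$ of resources; put $n=|N|$, $m=|R|$. Each player $i$ has a function $f^{(i)}:2^R\to\mathbb N$ that is submodular, monotone and satisfies $f^{(i)}(\emptyset)=0$, a demand $d_i\in\mathbb N$ with $1\le d_i\le f^{(i)}(R)$, and cost functions $c_{i,r}:\mathbb N\to\mathbb N$ ($r\in R$). Each $c_{i,r}$ is nondecreasing and $u$-truncated strongly semi-convex for $u=f^{(i)}(\{r\})$, i.e. $c(a+x)x-c(a+x-1)(x-1)\le c(b+y)y-c(b+y-1)(y-1)$ for all integers $1\le x\le y\le u$ and $0\le a\le b$. For $e\in\mathbb N$ let $X_i(e)=\{x\in\mathbb N^R:\sum_{r\in U}x_r\le f^{(i)}(U)\ \forall U\subseteq R,\ \sum_{r\in R}x_r=e\}$. The strategies of player $i$ are the elements of $X_i(d_i)$, and the private cost in a profile $x$ is $\pi_i(x)=\sum_{r\in R}c_{i,r}(x_r)\,x_{i,r}$ with $x_r=\sum_{j\in N}x_{j,r}$. A best response of $i$ minimizes $\pi_i$ over the strategies of $i$, with the strategies of the others fixed; a pure Nash equilibrium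 is a profile of strategies in which everybody plays a best response. Let $\delta=\max_i d_i$ and $H(x,y)=\sum_{r}|x_r-y_r|$. **Algorithm 1.** Start with $\bar d_i=0$ and $x_i=0$ for all $i$. For $k=1,\dots,\sum_i d_i$: choose some $i$ with $\bar d_i<d_i$, increase $\bar d_i$ by one, choose a best response $y_i\in X_i(\bar d_i)$ with $H(y_i,x_i)=1$ and set $x_i\leftarrow y_i$; then, while some player can improve in the game with the demands $\bar d$, take such a player $i$, choose a best response $y_i\in X_i(\bar d_i)$ with $H(y_i,x_i)=2$ and set $x_i\leftarrow y_i$. Return $x$. **Corollary.** (a) Whatever choices it makes, Algorithm 1 runs for at most $n^{\delta+1}m^{\delta}\delta^{\delta+1}$ iterations, where the iterations of the for-loop and those of the while-loop are all counted; it never gets stuck (the required best responses always exist), and the profile that it returns is a pure Nash equilibrium. (b) Hence a pure Nash equilibrium can be computed in polynomial time when $\delta$ is constant: there is one random access machine program that uses value oracles for the $f^{(i)}$ and the $c_{i,r}$ and whose time is measured at logarithmic cost, such that for every constant $\delta$ there is a polynomial $P$ with the following property. For every congestion game on integral polymatroids with players $0,\dots,n-1$, resources $0,\dots,m-1$ ($n,m\ge1$)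 and all demands at most $\delta$, the program, given $n$, $m$ and the demands, halts after time at most $P(n+m+\beta)$ and outputs a pure Nash equilibrium. Here $\beta$ is the largest bit length of the values $f^{(i)}(U)$ ($i\in N$, $U\subseteq R$) and $c_{i,r}(x)$ ($i\in N$, $r\in R$, $0\le x\le\sum_j d_j$). -/

import Mathlib

/-- An integral polymatroid rank function on the finite set `R` of resources. -/
structure PolymatroidRank (R : Type*) [DecidableEq R] where
  rank : Finset R → ℕ
  normalized : rank ∅ = 0
  monotone : ∀ U V : Finset R, U ⊆ V → rank U ≤ rank V
  submodular : ∀ U V : Finset R, rank (U ∪ V) + rank (U ∩ V) ≤ rank U + rank V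

/-- The integral polymatroid base polyhedron of `f` with demand `d`. -/
def PolymatroidRank.base {R : Type*} [Fintype R] [DecidableEq R]
    (f : PolymatroidRank R) (d : ℕ) : Set (R → ℕ) :=
  {x | (∀ U : Finset R, ∑ r ∈ U, x r ≤ f.rank U) ∧ ∑ r, x r = d}

/-- `c` is `u`-truncated strongly semi-convex. The inequality is read in `ℤ`; the inner natural
subtractions are exact because `1 ≤ x` and `1 ≤ y`. The condition is void for `u = 0`. -/
def TruncStronglySemiConvex (u : ℕ) (c : ℕ → ℕ) : Prop :=
  ∀ x y a b : ℕ, 1 ≤ x → x ≤ y → y ≤ u → a ≤ b →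
    (c (a + x) * x : ℤ) - c (a + x - 1) * (x - 1) ≤
      (c (b + y) * y : ℤ) - c (b + y - 1) * (y - 1)

/-- A congestion game on integral polymatroids with players `N` and resources `R`, with
player-specific costs that are nondecreasing and truncated strongly semi-convex. -/
structure PolymatroidGame (N R : Type*) [Fintype R] [DecidableEq R] where
  demand : N → ℕ
  f : N → PolymatroidRank R
  c : N → R → ℕ → ℕ
  demand_pos : ∀ i, 1 ≤ demand i
  demand_le : ∀ i, demand i ≤ (f i).rank Finset.univ
  cost_mono : ∀ i r, Monotone (c i r)
  cost_ssc : ∀ i r, TruncStronglySemiConvex ((f i).rank {r}) (c i r)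

namespace PolymatroidGame

section Game

variable {N R : Type*} [Fintype N] [DecidableEq N] [Fintype R] [DecidableEq R]

/-- The private cost `∑ r, c i r (x_r) * x i r`, where `x_r = ∑ j, x j r`. -/
def privateCost (G : PolymatroidGame N R) (x : N → R → ℕ) (i : N) : ℕ :=
  ∑ r, G.c i r (∑ j, x j r) * x i r

/-- In the game with demands `e`, the strategy `y` is a best response of player `i` to the
strategies of the other players in `x`. -/
def IsBestResponse (G : PolymatroidGame N R) (e : N → ℕ) (x : N → R → ℕ) (i : N)
    (y : R → ℕ) : Prop :=
  y ∈ (G.f i).base (e i) ∧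
    ∀ z ∈ (G.f i).base (e i),
      G.privateCost (Function.update x i y) i ≤ G.privateCost (Function.update x i z) i

/-- In the game with demands `e`, player `i` can strictly improve on the profile `x`. -/
def CanImprove (G : PolymatroidGame N R) (e : N → ℕ) (x : N → R → ℕ) (i : N) : Prop :=
  ∃ y ∈ (G.f i).base (e i), G.privateCost (Function.update x i y) i < G.privateCost x i

/-- `x` is a pure Nash equilibrium of `G`. -/
def IsPureNash (G : PolymatroidGame N R) (x : N → R → ℕ) : Prop :=
  ∀ i, G.IsBestResponse G.demand x i (x i)

/-- The distance `∑ r, |x r - y r|`. -/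
def hamming (x y : R → ℕ) : ℕ := ∑ r, ((x r : ℤ) - (y r : ℤ)).natAbs

/-- The variables of the algorithm: the number `k` of iterations of the for-loop started so far,
the preliminary demands and the preliminary strategies. -/
structure AlgState (N R : Type*) where
  k : ℕ
  demand : N → ℕ
  profile : N → R → ℕ

/-- All variables are set to zero. -/
def AlgState.init (N R : Type*) : AlgState N R := ⟨0, fun _ => 0, fun _ _ => 0⟩

/-- One iteration of the algorithm. All choices are free.
`forStep`: the while-loop is not entered (again), so the next iteration of the for-loop starts:
some player `i` whose preliminary demand is below the demand gets one more unit of demand and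
moves to a best response at distance one.
`whileStep`: one iteration of the while-loop: some player `i` who can improve in the game with
the preliminary demands moves to a best response at distance two. -/
inductive AlgStep (G : PolymatroidGame N R) : AlgState N R → AlgState N R → Prop
  | forStep (s : AlgState N R) (i : N) (y : R → ℕ)
      (hk : s.k < ∑ j, G.demand j)
      (hexit : ¬ ∃ j, G.CanImprove s.demand s.profile j)
      (hi : s.demand i < G.demand i)
      (hy : G.IsBestResponse (Function.update s.demand i (s.demand i + 1)) s.profile i y)
      (hd : hamming y (s.profile i) = 1) :
      AlgStep G s ⟨s.k + 1, Function.update s.demand i (s.demand i + 1),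
        Function.update s.profile i y⟩
  | whileStep (s : AlgState N R) (i : N) (y : R → ℕ)
      (hi : G.CanImprove s.demand s.profile i)
      (hy : G.IsBestResponse s.demand s.profile i y)
      (hd : hamming y (s.profile i) = 2) :
      AlgStep G s ⟨s.k, s.demand, Function.update s.profile i y⟩

/-- `G.AlgRun T s`: the algorithm can be in state `s` after exactly `T` iterations, where the
iterations of the for-loop and those of the while-loop are all counted. -/
inductive AlgRun (G : PolymatroidGame N R) : ℕ → AlgState N R → Prop
  | start : AlgRun G 0 (AlgState.init N R)
  | step {T : ℕ} {s s' : AlgState N R} (h : AlgRun G T s) (h' : AlgStep G s s') :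
      AlgRun G (T + 1) s'

/-- The algorithm returns in state `s`: the for-loop is exhausted and the while-loop is left. -/
def AlgReturns (G : PolymatroidGame N R) (s : AlgState N R) : Prop :=
  s.k = ∑ j, G.demand j ∧ ¬ ∃ j, G.CanImprove s.demand s.profile j

/-- The maximum demand. -/
def maxDemand (G : PolymatroidGame N R) : ℕ := Finset.univ.sup G.demand

/-- The largest bit length of a value of a rank function, or of a value of a cost function at a
load that is at most the total demand. -/
def maxBits (G : PolymatroidGame N R) : ℕ :=
  (Finset.univ.sup fun i => Finset.univ.sup fun U : Finset R => Nat.size ((G.f i).rank U)) ⊔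
    (Finset.univ.sup fun i => Finset.univ.sup fun r =>
      (Finset.range (∑ j, G.demand j + 1)).sup fun x => Nat.size (G.c i r x))

end Game

end PolymatroidGame

/-! ### Random access machines with value oracles, at logarithmic cost

The memory consists of arrays of natural numbers. A program names finitely many of them, and it
computes addresses inside an array. -/

/-- `μ a j` is the entry of array `a` at address `j`. -/
abbrev RamMem := ℕ → ℕ → ℕ

/-- The memory after `a[j] := v`. -/
def RamMem.write (μ : RamMem) (a j v : ℕ) : RamMem :=
  Function.update μ a (Function.update (μ a) j v)

/-- Expressions: literals, array access, arithmetic (with truncated subtraction), and the two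
oracle queries: `rank i a` asks for the rank function of player `i` at the set of those resources
whose entry in array `a` is nonzero, and `cost i r x` for the cost function of player `i` on
resource `r` at load `x`. -/
inductive RamExpr : Type
  | lit (v : ℕ)
  | get (a : ℕ) (j : RamExpr)
  | add (e₁ e₂ : RamExpr)
  | sub (e₁ e₂ : RamExpr)
  | mul (e₁ e₂ : RamExpr)
  | rank (i : RamExpr) (a : ℕ)
  | cost (i r x : RamExpr)

/-- Programs. A condition counts as true when its value is nonzero. -/
inductive RamProg : Type
  | skip
  | assign (a : ℕ) (j e : RamExpr)
  | seq (p q : RamProg)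
  | ite (e : RamExpr) (p q : RamProg)
  | loop (e : RamExpr) (p : RamProg)

section Ram

variable {n m : ℕ}

/-- The answer to a rank query; it is `0` for a player that does not exist. -/
def rankOracle (G : PolymatroidGame (Fin n) (Fin m)) (i : ℕ) (A : ℕ → ℕ) : ℕ :=
  if h : i < n then (G.f ⟨i, h⟩).rank (Finset.univ.filter fun r : Fin m => A r ≠ 0) else 0

/-- The answer to a cost query; it is `0` for a player or a resource that does not exist. -/
def costOracle (G : PolymatroidGame (Fin n) (Fin m)) (i r x : ℕ) : ℕ :=
  if h : i < n ∧ r < m then G.c ⟨i, h.1⟩ ⟨r, h.2⟩ x else 0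

/-- The value of an expression. -/
def RamExpr.val (G : PolymatroidGame (Fin n) (Fin m)) (μ : RamMem) : RamExpr → ℕ
  | .lit v => v
  | .get a j => μ a (j.val G μ)
  | .add e₁ e₂ => e₁.val G μ + e₂.val G μ
  | .sub e₁ e₂ => e₁.val G μ - e₂.val G μ
  | .mul e₁ e₂ => e₁.val G μ * e₂.val G μ
  | .rank i a => rankOracle G (i.val G μ) (μ a)
  | .cost i r x => costOracle G (i.val G μ) (r.val G μ) (x.val G μ)

/-- The time for evaluating an expression: every operation costs one plus the bit length of its
result, in addition to the time for its arguments, and a rank query costs `m` more, the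
length of the description of the set. -/
def RamExpr.time (G : PolymatroidGame (Fin n) (Fin m)) (μ : RamMem) : RamExpr → ℕ
  | .lit v => 1 + Nat.size v
  | .get a j => j.time G μ + 1 + Nat.size (RamExpr.val G μ (.get a j))
  | .add e₁ e₂ => e₁.time G μ + e₂.time G μ + 1 + Nat.size (RamExpr.val G μ (.add e₁ e₂))
  | .sub e₁ e₂ => e₁.time G μ + e₂.time G μ + 1 + Nat.size (RamExpr.val G μ (.sub e₁ e₂))
  | .mul e₁ e₂ => e₁.time G μ + e₂.time G μ + 1 + Nat.size (RamExpr.val G μ (.mul e₁ e₂))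
  | .rank i a => i.time G μ + m + 1 + Nat.size (RamExpr.val G μ (.rank i a))
  | .cost i r x =>
      i.time G μ + r.time G μ + x.time G μ + 1 + Nat.size (RamExpr.val G μ (.cost i r x))

/-- `RamExec G p μ t μ'`: with the oracles of `G`, the program `p` started in memory `μ` halts
after time `t` in memory `μ'`. -/
inductive RamExec (G : PolymatroidGame (Fin n) (Fin m)) :
    RamProg → RamMem → ℕ → RamMem → Prop
  | skip (μ : RamMem) : RamExec G .skip μ 1 μ
  | assign (μ : RamMem) (a : ℕ) (j e : RamExpr) :
      RamExec G (.assign a j e) μ (j.time G μ + e.time G μ + 1)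
        (μ.write a (j.val G μ) (e.val G μ))
  | seq {p q : RamProg} {μ μ' μ'' : RamMem} {t t' : ℕ}
      (h : RamExec G p μ t μ') (h' : RamExec G q μ' t' μ'') :
      RamExec G (.seq p q) μ (t + t' + 1) μ''
  | ite_true {e : RamExpr} {p q : RamProg} {μ μ' : RamMem} {t : ℕ}
      (he : e.val G μ ≠ 0) (h : RamExec G p μ t μ') :
      RamExec G (.ite e p q) μ (e.time G μ + t + 1) μ'
  | ite_false {e : RamExpr} {p q : RamProg} {μ μ' : RamMem} {t : ℕ}
      (he : e.val G μ = 0) (h : RamExec G q μ t μ') :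
      RamExec G (.ite e p q) μ (e.time G μ + t + 1) μ'
  | loop_true {e : RamExpr} {p : RamProg} {μ μ' μ'' : RamMem} {t t' : ℕ}
      (he : e.val G μ ≠ 0) (h : RamExec G p μ t μ') (h' : RamExec G (.loop e p) μ' t' μ'') :
      RamExec G (.loop e p) μ (e.time G μ + t + t' + 1) μ''
  | loop_false {e : RamExpr} {p : RamProg} {μ : RamMem}
      (he : e.val G μ = 0) :
      RamExec G (.loop e p) μ (e.time G μ + 1) μ

/-- The input: array `0` starts with `n` and `m`, array `1` starts with the demands, and all other
entries are `0`. The rank and cost functions are given by the oracles. -/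
def ramInput (G : PolymatroidGame (Fin n) (Fin m)) : RamMem := fun a j =>
  if a = 0 then (if j = 0 then n else if j = 1 then m else 0)
  else if a = 1 then (if h : j < n then G.demand ⟨j, h⟩ else 0)
  else 0

/-- The output: array `2` holds the strategies, row by row. -/
def ramOutput (n m : ℕ) (μ : RamMem) : Fin n → Fin m → ℕ := fun i r => μ 2 (i * m + r)

end Ram

/-!
A strategy is a best response if and only if no exchange of a single unit improves it: this follows
from the exchange property of polymatroid bases, because by strong semi-convexity the cost of every
further unit on a resource is at least that of the previous one.

After a player has added a unit on the resource `r`, only `r` has become more expensive for the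
others. So it suffices that one of them moves a unit away from `r`, to `s` say, and then the same
holds with `s` in place of `r`. In the meantime the loads without the marked unit do not change. At
these loads, every such move replaces the cost of a unit by a smaller one. There are at most
`m * δ` different values for the costs of the units of one player, so the sum of the ranks of these
costs, over all players and all their units, is at most `n * m * δ ^ 2` and decreases in every
iteration of a while-loop. There are at most `n * δ` while-loops.

For a program that works in polynomial time for constant `δ`, it suffices to test the polymatroid
constraints for the subsets of the support of a strategy, of which there are at most `2 ^ δ`. Since
the program stores only numbers that are computed without multiplication, the numbers stay short,
and counting instructions is enough.
-/

section Units

variable {R : Type*} [DecidableEq R]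

/-- The vector `x` with one more unit on `p`. -/
def addUnit (x : R → ℕ) (p : R) : R → ℕ := x + Pi.single p 1

/-- The vector `x` with one unit less on `p`, truncated at zero. -/
def subUnit (x : R → ℕ) (p : R) : R → ℕ := x - Pi.single p 1

theorem addUnit_apply (x : R → ℕ) (p r : R) : addUnit x p r = x r + if r = p then 1 else 0 := by
  simp [addUnit, Pi.single_apply]

@[simp] theorem addUnit_self (x : R → ℕ) (p : R) : addUnit x p p = x p + 1 := by
  simp [addUnit]

theorem addUnit_of_ne (x : R → ℕ) {p r : R} (h : r ≠ p) : addUnit x p r = x r := by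
  simp [addUnit, h]

theorem update_add_one_eq_addUnit (x : R → ℕ) (p : R) :
    Function.update x p (x p + 1) = addUnit x p := by
  ext r
  obtain rfl | hr := eq_or_ne r p
  · simp
  · simp [addUnit_of_ne, hr]

theorem le_addUnit (x : R → ℕ) (p : R) : x ≤ addUnit x p := le_self_add

theorem addUnit_comm (x : R → ℕ) (p q : R) : addUnit (addUnit x p) q = addUnit (addUnit x q) p :=
  add_right_comm _ _ _

theorem addUnit_injective (p : R) : Function.Injective fun x : R → ℕ => addUnit x p :=
  add_left_injective _

theorem exists_eq_addUnit {x : R → ℕ} {p : R} (h : 0 < x p) : ∃ y, x = addUnit y p :=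
  ⟨subUnit x p, (tsub_add_cancel_of_le (update_le_iff.2 ⟨h, fun _ _ => zero_le⟩)).symm⟩

theorem addUnit_eq_addUnit {x y : R → ℕ} {p q : R} (hpq : p ≠ q)
    (h : addUnit x p = addUnit y q) : ∃ z, x = addUnit z q ∧ y = addUnit z p := by
  have hq : 0 < x q := by
    have := congrFun h q
    rw [addUnit_of_ne _ hpq.symm, addUnit_self] at this
    omega
  obtain ⟨z, rfl⟩ := exists_eq_addUnit hq
  exact ⟨z, rfl, addUnit_injective q (h.symm.trans (addUnit_comm z q p))⟩

theorem sum_addUnit (x : R → ℕ) (p : R) (U : Finset R) :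
    ∑ r ∈ U, addUnit x p r = ∑ r ∈ U, x r + if p ∈ U then 1 else 0 := by
  simp [addUnit_apply, Finset.sum_add_distrib]

theorem univ_sum_addUnit [Fintype R] (x : R → ℕ) (p : R) :
    ∑ r, addUnit x p r = ∑ r, x r + 1 := by
  simp [sum_addUnit]

@[simp] theorem subUnit_addUnit (x : R → ℕ) (p : R) : subUnit (addUnit x p) p = x :=
  add_tsub_cancel_right _ _

theorem subUnit_of_ne (x : R → ℕ) {p r : R} (h : r ≠ p) : subUnit x p r = x r := by
  simp [subUnit, h]

theorem subUnit_eq_self_or_exists_eq_addUnit (x : R → ℕ) (p : R) :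
    subUnit x p = x ∨ ∃ y, x = addUnit y p := by
  obtain hp | hp := Nat.eq_zero_or_pos (x p)
  · refine .inl (funext fun r => ?_)
    obtain rfl | hr := eq_or_ne r p
    · simp [subUnit, hp]
    · exact subUnit_of_ne x hr
  · exact .inr (exists_eq_addUnit hp)

theorem sum_comp_addUnit [Fintype R] {M : Type*} [AddCommGroup M] (C : R → ℕ → M) (x : R → ℕ)
    (p : R) : ∑ r, C r (addUnit x p r) = ∑ r, C r (x r) + (C p (x p + 1) - C p (x p)) := by
  rw [← sub_eq_iff_eq_add', ← Finset.sum_sub_distrib, Finset.sum_eq_single p]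
  · rw [addUnit_self]
  · intro r _ hr
    rw [addUnit_of_ne x hr, sub_self]
  · simp

theorem sum_sum_range_addUnit [Fintype R] {M : Type*} [AddCommMonoid M] (g : R → ℕ → M)
    (x : R → ℕ) (p : R) : ∑ r, ∑ k ∈ Finset.range (addUnit x p r), g r k =
      ∑ r, ∑ k ∈ Finset.range (x r), g r k + g p (x p) := by
  have hne : ∀ r ∈ Finset.univ.erase p, addUnit x p r = x r := fun r hr =>
    addUnit_of_ne x (Finset.ne_of_mem_erase hr)
  rw [← Finset.sum_erase_add _ _ (Finset.mem_univ p), addUnit_self, Finset.sum_range_succ,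
    ← add_assoc, Finset.sum_congr rfl fun r hr => by rw [hne r hr],
    Finset.sum_erase_add _ _ (Finset.mem_univ p)]

theorem exists_eq_single_of_sum_eq_one [Fintype R] {x : R → ℕ} (h : ∑ r, x r = 1) :
    ∃ p, x = Pi.single p 1 := by
  obtain ⟨p, -, hp⟩ : ∃ p ∈ Finset.univ, x p ≠ 0 :=
    Finset.exists_ne_zero_of_sum_ne_zero (by omega)
  obtain ⟨y, rfl⟩ := exists_eq_addUnit (Nat.pos_of_ne_zero hp)
  have hy : y = 0 := by
    rw [univ_sum_addUnit, add_eq_right, Finset.sum_eq_zero_iff] at h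
    exact funext fun r => h r (Finset.mem_univ r)
  exact ⟨p, by simp [hy, addUnit]⟩

end Units

/-! ### Bases of integral polymatroids -/

namespace PolymatroidRank

variable {R : Type*} [DecidableEq R] {f : PolymatroidRank R} {d : ℕ}

/-- Membership in the integral polymatroid of `f`; the bases are the members with a prescribed
sum. -/
def Indep (f : PolymatroidRank R) (x : R → ℕ) : Prop := ∀ U, ∑ r ∈ U, x r ≤ f.rank U

/-- The polymatroid constraint of `U` holds for `x` with equality. -/
def IsTight (f : PolymatroidRank R) (x : R → ℕ) (U : Finset R) : Prop := ∑ r ∈ U, x r = f.rank U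

theorem Indep.mono {x y : R → ℕ} (hy : f.Indep y) (hxy : x ≤ y) : f.Indep x := fun U =>
  (Finset.sum_le_sum fun r _ => hxy r).trans (hy U)

theorem Indep.isTight_union_inter {x : R → ℕ} (hx : f.Indep x) {U V : Finset R}
    (hU : f.IsTight x U) (hV : f.IsTight x V) : f.IsTight x (U ∪ V) ∧ f.IsTight x (U ∩ V) := by
  have hsub := f.submodular U V
  have hunion := hx (U ∪ V)
  have hinter := hx (U ∩ V)
  have hsum := Finset.sum_union_inter (s₁ := U) (s₂ := V) (f := x)
  unfold IsTight at *
  omega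

theorem Indep.exists_isTight_of_not_addUnit {x : R → ℕ} {p : R} (hx : f.Indep x)
    (h : ¬ f.Indep (addUnit x p)) : ∃ U, p ∈ U ∧ f.IsTight x U := by
  simp only [Indep, not_forall, not_le, sum_addUnit] at h
  obtain ⟨U, hU⟩ := h
  have hxU := hx U
  split_ifs at hU with hp
  · exact ⟨U, hp, by unfold IsTight; omega⟩
  · omega

theorem Indep.exists_isTight_forall_notMem [Finite R] {x : R → ℕ} (hx : f.Indep x) :
    ∃ T, f.IsTight x T ∧ ∀ p ∉ T, f.Indep (addUnit x p) := by
  classical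
  cases nonempty_fintype R
  refine ⟨(Finset.univ.filter (f.IsTight x)).sup id, Finset.sup_induction ?_ ?_ ?_,
    fun p hp => ?_⟩
  · simp [IsTight, f.normalized]
  · exact fun U hU V hV => (hx.isTight_union_inter hU hV).1
  · simp
  · by_contra h
    obtain ⟨U, hpU, hU⟩ := hx.exists_isTight_of_not_addUnit h
    exact hp (Finset.le_sup (f := id) (by simpa using hU : U ∈ _) hpU)

variable [Fintype R]

theorem Indep.exists_isTight_forall_mem {x : R → ℕ} (hx : f.Indep x)
    (huniv : f.IsTight x Finset.univ) (p : R) :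
    ∃ D, p ∈ D ∧ f.IsTight x D ∧ ∀ q ∈ D, ∀ w, x = addUnit w q → f.Indep (addUnit w p) := by
  classical
  set D := (Finset.univ.filter fun U => p ∈ U ∧ f.IsTight x U).inf id with hD
  obtain ⟨hpD, hDtight⟩ : p ∈ D ∧ f.IsTight x D := by
    refine Finset.inf_induction (p := fun U => p ∈ U ∧ f.IsTight x U) ⟨Finset.mem_univ p, huniv⟩
      (fun U hU V hV => ?_) (by simp)
    exact ⟨Finset.mem_inter.2 ⟨hU.1, hV.1⟩, (hx.isTight_union_inter hU.2 hV.2).2⟩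
  refine ⟨D, hpD, hDtight, ?_⟩
  rintro q hq w rfl
  by_contra h
  obtain ⟨U, hpU, hU⟩ := (hx.mono (le_addUnit w q)).exists_isTight_of_not_addUnit h
  have hsum := hx U
  rw [sum_addUnit, ← hU] at hsum
  have hqU : q ∉ U := fun hqU => by simp [hqU] at hsum
  have hUtight : f.IsTight (addUnit w q) U := by
    rw [IsTight, sum_addUnit, if_neg hqU, add_zero]
    exact hU
  exact hqU (Finset.inf_le (f := id) (by simp [hpU, hUtight] : U ∈ _) hq)

/-- The rank function cut off at `d`. It has the same bases of demand `d`, and each of them is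
tight on the whole ground set. -/
def truncate (f : PolymatroidRank R) (d : ℕ) : PolymatroidRank R where
  rank U := min (f.rank U) d
  normalized := by simp [f.normalized]
  monotone U V h := min_le_min_right _ (f.monotone U V h)
  submodular U V := by
    have hUV := f.submodular U V
    have hU := f.monotone U (U ∪ V) Finset.subset_union_left
    have hV := f.monotone V (U ∪ V) Finset.subset_union_right
    have hU' := f.monotone (U ∩ V) U Finset.inter_subset_left
    have hV' := f.monotone (U ∩ V) V Finset.inter_subset_right
    omega

theorem base_truncate (f : PolymatroidRank R) (d : ℕ) : (f.truncate d).base d = f.base d := by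
  ext x
  refine and_congr_left fun hx => forall_congr' fun U => ?_
  have : ∑ r ∈ U, x r ≤ d := hx ▸ Finset.sum_le_sum_of_subset (Finset.subset_univ U)
  simp [truncate, this]

theorem exchange_of_rank_univ (hd : f.rank Finset.univ = d) {x y : R → ℕ} {p : R}
    (hx : addUnit x p ∈ f.base d) (hy : y ∈ f.base d) :
    ∃ q w, y = addUnit w q ∧ x q < y q ∧ addUnit x q ∈ f.base d ∧ addUnit w p ∈ f.base d := by
  have hx_indep : f.Indep x := Indep.mono hx.1 (le_addUnit x p)
  obtain ⟨T, hT, hT_add⟩ := hx_indep.exists_isTight_forall_notMem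
  obtain ⟨D, hpD, hD, hD_add⟩ := Indep.exists_isTight_forall_mem hy.1 (hy.2.trans hd.symm) p
  have hlt : ∑ r ∈ D \ T, x r < ∑ r ∈ D \ T, y r := by
    have hunion := hx.1 (D ∪ T)
    rw [sum_addUnit, if_pos (Finset.mem_union_left T hpD), ← Finset.sdiff_union_self_eq_union,
      Finset.sum_union Finset.sdiff_disjoint, Finset.sdiff_union_self_eq_union] at hunion
    have hinter := hy.1 (D ∩ T)
    have hsub := f.submodular D T
    rw [← hD, ← hT, ← Finset.sum_inter_add_sum_sdiff D T y] at hsub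
    omega
  obtain ⟨q, hq, hlt⟩ := Finset.exists_lt_of_sum_lt hlt
  obtain ⟨hqD, hqT⟩ := Finset.mem_sdiff.1 hq
  obtain ⟨w, rfl⟩ := exists_eq_addUnit (Nat.zero_lt_of_lt hlt)
  refine ⟨q, w, rfl, hlt, ⟨hT_add q hqT, ?_⟩, ⟨hD_add q hqD w rfl, ?_⟩⟩
  · rw [← hx.2, univ_sum_addUnit, univ_sum_addUnit]
  · rw [← hy.2, univ_sum_addUnit, univ_sum_addUnit]

theorem exchange {x y : R → ℕ} {p : R} (hx : addUnit x p ∈ f.base d) (hy : y ∈ f.base d) :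
    ∃ q w, y = addUnit w q ∧ x q < y q ∧ addUnit x q ∈ f.base d ∧ addUnit w p ∈ f.base d := by
  have hd : (f.truncate d).rank Finset.univ = d := min_eq_right (hy.2 ▸ hy.1 Finset.univ)
  rw [← base_truncate] at hx hy ⊢
  exact exchange_of_rank_univ hd hx hy

theorem exists_addUnit_mem_base {x : R → ℕ} (hx : x ∈ f.base d) (hd : d < f.rank Finset.univ) :
    ∃ p, addUnit x p ∈ f.base (d + 1) := by
  obtain ⟨T, hT, hT_add⟩ := Indep.exists_isTight_forall_notMem hx.1
  obtain ⟨p, hp⟩ : ∃ p, p ∉ T := by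
    by_contra! h
    rw [← Finset.eq_univ_iff_forall.2 h, ← hT] at hd
    exact hd.not_ge (hx.2 ▸ Finset.sum_le_sum_of_subset (Finset.subset_univ T))
  exact ⟨p, hT_add p hp, by rw [univ_sum_addUnit, hx.2]⟩

theorem mem_base_of_addUnit_mem_base {x : R → ℕ} {p : R} (h : addUnit x p ∈ f.base (d + 1)) :
    x ∈ f.base d :=
  ⟨Indep.mono h.1 (le_addUnit x p), by simpa [univ_sum_addUnit] using h.2⟩

theorem le_rank_singleton {x : R → ℕ} (hx : x ∈ f.base d) (r : R) : x r ≤ f.rank {r} := by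
  simpa using hx.1 {r}

/-- `x` is a base, and moving one unit of it does not decrease the separable function whose
increments are `φ r k`: the increment of the unit that leaves is at most that of the new one. -/
def LocallyOptimal (f : PolymatroidRank R) (d : ℕ) (φ : R → ℕ → ℤ) (x : R → ℕ) : Prop :=
  x ∈ f.base d ∧ ∀ z p q, x = addUnit z p → addUnit z q ∈ f.base d → φ p (z p) ≤ φ q (z q)

theorem LocallyOptimal.of_ne {φ : R → ℕ → ℤ} {x : R → ℕ} (hx : x ∈ f.base d)
    (h : ∀ z p q, p ≠ q → x = addUnit z p → addUnit z q ∈ f.base d → φ p (z p) ≤ φ q (z q)) :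
    f.LocallyOptimal d φ x := by
  refine ⟨hx, fun z p q hp hq => ?_⟩
  obtain rfl | hpq := eq_or_ne p q
  exacts [le_rfl, h z p q hpq hp hq]

theorem sum_tsub_addUnit_lt {x w : R → ℕ} {p q : R} (hp : w p < x p) (hq : x q ≤ w q) :
    ∑ r, (x r - addUnit w p r) < ∑ r, (x r - addUnit w q r) := by
  refine Finset.sum_lt_sum (fun r _ => ?_) ⟨p, Finset.mem_univ p, ?_⟩
  · simp only [addUnit_apply]
    split_ifs <;> subst_vars <;> omega
  · have hpq : p ≠ q := by rintro rfl; omega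
    rw [addUnit_self, addUnit_of_ne _ hpq]
    omega

theorem LocallyOptimal.sum_le {C : R → ℕ → ℤ}
    (hC : ∀ r k l, k ≤ l → l + 1 ≤ f.rank {r} → C r (k + 1) - C r k ≤ C r (l + 1) - C r l)
    {x : R → ℕ} (hx : f.LocallyOptimal d (fun r k => C r (k + 1) - C r k) x)
    {y : R → ℕ} (hy : y ∈ f.base d) : ∑ r, C r (x r) ≤ ∑ r, C r (y r) := by
  induction hD : ∑ r, (x r - y r) using Nat.strong_induction_on generalizing y with
  | _ D ih =>
  by_cases hle : ∀ r, x r ≤ y r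
  · have heq := (Finset.sum_eq_sum_iff_of_le fun r _ => hle r).1 (hx.1.2.trans hy.2.symm)
    exact (Finset.sum_congr rfl fun r hr => by rw [heq r hr]).le
  push Not at hle
  obtain ⟨p, hp⟩ := hle
  obtain ⟨z, rfl⟩ := exists_eq_addUnit (Nat.zero_lt_of_lt hp)
  rw [addUnit_self] at hp
  obtain ⟨q, w, rfl, hq, hzq, hwp⟩ := exchange hx.1 hy
  have hqp : q ≠ p := by rintro rfl; omega
  rw [addUnit_self] at hq
  rw [addUnit_of_ne _ hqp.symm] at hp
  have hmove : C p (z p + 1) - C p (z p) ≤ C q (z q + 1) - C q (z q) := hx.2 z p q rfl hzq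
  have hconvex_p := hC p (w p) (z p) (by omega) (by simpa using le_rank_singleton hx.1 p)
  have hconvex_q := hC q (z q) (w q) (by omega) (by simpa using le_rank_singleton hy q)
  have hcloser := sum_tsub_addUnit_lt (x := addUnit z p) (w := w) (p := p) (q := q)
    (by rw [addUnit_self]; omega) (by rw [addUnit_of_ne _ hqp]; omega)
  have hopt := ih _ (hD ▸ hcloser) hwp rfl
  rw [sum_comp_addUnit C w] at hopt ⊢
  linarith

theorem LocallyOptimal.of_forall_sum_le {C : R → ℕ → ℤ} {x : R → ℕ} (hx : x ∈ f.base d)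
    (h : ∀ y ∈ f.base d, ∑ r, C r (x r) ≤ ∑ r, C r (y r)) :
    f.LocallyOptimal d (fun r k => C r (k + 1) - C r k) x := by
  refine ⟨hx, ?_⟩
  rintro z p q rfl hq
  have := h _ hq
  rw [sum_comp_addUnit, sum_comp_addUnit] at this
  exact le_of_add_le_add_left this

end PolymatroidRank

/-! ### Best responses when loads change by one unit -/

namespace PolymatroidGame

open PolymatroidRank

section MarginalCost

variable {N R : Type*} [Fintype R] [DecidableEq R] (G : PolymatroidGame N R)

/-- The increase of the cost of player `i` on resource `r` when `i` adds a unit there, at load `L`,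
of which `k` units belong to `i`. -/
def inc (i : N) (r : R) (L k : ℕ) : ℤ := G.c i r (L + 1) * (k + 1) - G.c i r L * k

/-- The price that player `i` with strategy `x` pays for one more unit on `r` when the other
players cause the load `a`. -/
def marginalCost (i : N) (a x : R → ℕ) (r : R) : ℤ := G.inc i r (a r + x r) (x r)

/-- `x` is a strategy of player `i` for demand `d`, and `i` cannot gain by moving one unit when the
other players cause the load `a`. -/
def OptAt (i : N) (d : ℕ) (a x : R → ℕ) : Prop :=
  (G.f i).LocallyOptimal d (fun r k => G.inc i r (a r + k) k) x

/-- Among the resources where one more unit completes `z` to a strategy of player `i` for demand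
`d`, the unit is cheapest on `r` when the other players cause the load `a`. -/
def IsCheapestUnit (i : N) (d : ℕ) (a z : R → ℕ) (r : R) : Prop :=
  addUnit z r ∈ (G.f i).base d ∧
    ∀ q, addUnit z q ∈ (G.f i).base d → G.marginalCost i a z r ≤ G.marginalCost i a z q

variable {G} {i : N} {d : ℕ} {a b x y z : R → ℕ} {p q r s : R}

theorem inc_mono {a b k l : ℕ} (hab : a ≤ b) (hkl : k ≤ l) (hl : l + 1 ≤ (G.f i).rank {r}) :
    G.inc i r (a + k) k ≤ G.inc i r (b + l) l := by
  simpa [inc, add_assoc] using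
    G.cost_ssc i r (k + 1) (l + 1) a b (Nat.le_add_left 1 k) (by omega) hl hab

theorem inc_le_inc {L k l : ℕ} (hkl : k ≤ l) : G.inc i r L k ≤ G.inc i r L l := by
  have hcost : (G.c i r L : ℤ) ≤ G.c i r (L + 1) := by exact_mod_cast G.cost_mono i r L.le_succ
  have := mul_le_mul_of_nonneg_right (Int.ofNat_le.2 hkl) (sub_nonneg.2 hcost)
  unfold inc
  linarith

theorem marginalCost_congr (ha : a r = b r) (hx : x r = y r) :
    G.marginalCost i a x r = G.marginalCost i b y r := by
  rw [marginalCost, marginalCost, ha, hx]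

theorem marginalCost_mono (ha : a r ≤ b r) (hx : x r ≤ y r)
    (hy : y r + 1 ≤ (G.f i).rank {r}) : G.marginalCost i a x r ≤ G.marginalCost i b y r :=
  inc_mono ha hx hy

theorem marginalCost_addUnit_load_le (i : N) (a x : R → ℕ) (r p : R) :
    G.marginalCost i (addUnit a r) x p ≤ G.marginalCost i a (addUnit x r) p := by
  obtain rfl | hpr := eq_or_ne p r
  · rw [marginalCost, marginalCost, addUnit_self, addUnit_self, add_right_comm, add_assoc]
    exact inc_le_inc (Nat.le_succ _)
  · exact (marginalCost_congr (addUnit_of_ne a hpr) (addUnit_of_ne x hpr).symm).le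

theorem add_one_le_rank_of_addUnit_mem_base (h : addUnit x r ∈ (G.f i).base d) :
    x r + 1 ≤ (G.f i).rank {r} := by
  simpa using le_rank_singleton h r

theorem OptAt.marginalCost_le (h : G.OptAt i d a (addUnit z p))
    (hq : addUnit z q ∈ (G.f i).base d) : G.marginalCost i a z p ≤ G.marginalCost i a z q :=
  h.2 z p q rfl hq

theorem OptAt.of_ne (hx : x ∈ (G.f i).base d)
    (h : ∀ z p q, p ≠ q → x = addUnit z p → addUnit z q ∈ (G.f i).base d →
      G.marginalCost i a z p ≤ G.marginalCost i a z q) : G.OptAt i d a x :=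
  LocallyOptimal.of_ne hx h

theorem OptAt.of_addUnit_load (h : G.OptAt i d (addUnit a s) x)
    (hs : ∀ z p, p ≠ s → x = addUnit z p → addUnit z s ∈ (G.f i).base d →
      G.marginalCost i a z p ≤ G.marginalCost i a z s) : G.OptAt i d a x := by
  refine .of_ne h.1 fun z p q hpq hp hq => ?_
  obtain rfl | hqs := eq_or_ne q s
  · exact hs z p hpq hp hq
  subst hp
  calc
    _ ≤ G.marginalCost i (addUnit a s) z p :=
      marginalCost_mono (le_addUnit a s p) le_rfl (add_one_le_rank_of_addUnit_mem_base h.1)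
    _ ≤ G.marginalCost i (addUnit a s) z q := h.marginalCost_le hq
    _ = _ := marginalCost_congr (addUnit_of_ne a hqs) rfl

theorem exists_isCheapestUnit (h : addUnit z q ∈ (G.f i).base d) :
    ∃ r, G.IsCheapestUnit i d a z r := by
  classical
  obtain ⟨r, hr, hmin⟩ := Finset.exists_min_image
    (Finset.univ.filter fun q => addUnit z q ∈ (G.f i).base d) (G.marginalCost i a z)
    ⟨q, by simpa using h⟩
  exact ⟨r, by simpa using hr, fun q hq => hmin q (by simpa using hq)⟩

theorem OptAt.insert (hx : G.OptAt i d a x) (hr : G.IsCheapestUnit i (d + 1) a x r) :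
    G.OptAt i (d + 1) a (addUnit x r) := by
  refine .of_ne hr.1 fun z p q _ hp hq => ?_
  obtain rfl | hpr := eq_or_ne p r
  · obtain rfl := addUnit_injective p hp
    exact hr.2 q hq
  obtain ⟨y, rfl, rfl⟩ := addUnit_eq_addUnit hpr.symm hp
  have hyq : addUnit y q ∈ (G.f i).base d :=
    mem_base_of_addUnit_mem_base (addUnit_comm y q r ▸ hq)
  calc
    _ = G.marginalCost i a y p := marginalCost_congr rfl (addUnit_of_ne y hpr)
    _ ≤ G.marginalCost i a y q := hx.marginalCost_le hyq
    _ ≤ _ := marginalCost_mono le_rfl (le_addUnit y r q) (add_one_le_rank_of_addUnit_mem_base hq)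

/-- By the exchange property, removing a unit from `p ≠ s` is compared with removing one from `p` in
the old strategy `addUnit z r`. -/
theorem OptAt.reinsert (hx : G.OptAt i d a (addUnit z r))
    (hs : G.IsCheapestUnit i d (addUnit a r) z s) :
    G.OptAt i d (addUnit a r) (addUnit z s) := by
  refine .of_ne hs.1 fun z' p q hpq hp hq => ?_
  obtain rfl | hps := eq_or_ne p s
  · obtain rfl := addUnit_injective p hp
    exact hs.2 q hq
  obtain ⟨y, rfl, rfl⟩ := addUnit_eq_addUnit hps.symm hp
  rw [addUnit_comm] at hx
  obtain ⟨v, w, hw, hv, hyv, hwp⟩ := exchange hx.1 hq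
  have hyp : G.marginalCost i (addUnit a r) (addUnit y s) p ≤
      G.marginalCost i a (addUnit y r) v :=
    calc
      _ = G.marginalCost i (addUnit a r) y p := marginalCost_congr rfl (addUnit_of_ne y hps)
      _ ≤ G.marginalCost i a (addUnit y r) p := marginalCost_addUnit_load_le i a y r p
      _ ≤ _ := hx.marginalCost_le hyv
  refine hyp.trans ?_
  obtain rfl | hvq := eq_or_ne v q
  · rw [addUnit_self, Nat.lt_succ_iff] at hv
    exact marginalCost_mono (le_addUnit a r v) hv (add_one_le_rank_of_addUnit_mem_base hq)
  rw [addUnit_of_ne _ hvq] at hv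
  obtain rfl : v = s := by
    by_contra hvs
    exact hv.not_ge (addUnit_of_ne y hvs ▸ le_addUnit y r v)
  have hvr : v ≠ r := by rintro rfl; exact hv.false
  obtain rfl : addUnit y q = w := addUnit_injective v ((addUnit_comm y q v).trans hw)
  calc
    _ = G.marginalCost i (addUnit a r) (addUnit y p) v := marginalCost_congr
      (addUnit_of_ne a hvr).symm ((addUnit_of_ne y hvr).trans (addUnit_of_ne y hps.symm).symm)
    _ ≤ G.marginalCost i (addUnit a r) (addUnit y p) q := hs.2 q (addUnit_comm y q p ▸ hwp)
    _ = _ := marginalCost_congr rfl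
      ((addUnit_of_ne y hpq.symm).trans (addUnit_of_ne y hvq.symm).symm)

theorem OptAt.of_move (hx : G.OptAt i d a (addUnit z r))
    (hy : G.OptAt i d (addUnit a r) (addUnit z s)) (hab : addUnit a r = addUnit b s) :
    G.OptAt i d b (addUnit z s) := by
  obtain rfl | hrs := eq_or_ne r s
  · rwa [← addUnit_injective r hab]
  obtain ⟨c, rfl, rfl⟩ := addUnit_eq_addUnit hrs hab
  rw [hab] at hy
  refine hy.of_addUnit_load fun z' p hps hp hs => ?_
  obtain ⟨y, rfl, rfl⟩ := addUnit_eq_addUnit hps.symm hp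
  rw [addUnit_comm] at hx
  obtain ⟨v, w, -, hv, hyv, -⟩ := exchange hx.1 hs
  obtain rfl : v = s := by
    by_contra hvs
    rw [addUnit_of_ne _ hvs, addUnit_of_ne _ hvs] at hv
    exact hv.not_ge (le_addUnit y r v)
  calc
    _ = G.marginalCost i (addUnit (addUnit c v) r) y p :=
      marginalCost_congr (by rw [hab, addUnit_of_ne _ hps]) (addUnit_of_ne y hps)
    _ ≤ G.marginalCost i (addUnit c v) (addUnit y r) p := marginalCost_addUnit_load_le ..
    _ ≤ G.marginalCost i (addUnit c v) (addUnit y r) v := hx.marginalCost_le hyv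
    _ = G.marginalCost i (addUnit c v) y v := marginalCost_congr rfl (addUnit_of_ne y hrs.symm)
    _ ≤ G.marginalCost i c (addUnit y v) v := marginalCost_addUnit_load_le ..
    _ = _ := marginalCost_congr (addUnit_of_ne c hrs.symm).symm rfl

theorem OptAt.of_insert (hx : G.OptAt i d (addUnit a r) x)
    (hy : G.OptAt i (d + 1) (addUnit a r) (addUnit x r)) : G.OptAt i (d + 1) a (addUnit x r) := by
  refine hy.of_addUnit_load fun z p hpr hp hr => ?_
  obtain ⟨y, rfl, rfl⟩ := addUnit_eq_addUnit hpr.symm hp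
  calc
    _ = G.marginalCost i (addUnit a r) y p :=
      marginalCost_congr (addUnit_of_ne a hpr).symm (addUnit_of_ne y hpr)
    _ ≤ G.marginalCost i (addUnit a r) y r :=
      hx.marginalCost_le (mem_base_of_addUnit_mem_base hr)
    _ ≤ _ := marginalCost_addUnit_load_le ..

end MarginalCost

section Profiles

variable {N R : Type*} [Fintype N] [DecidableEq N]

/-- The load of the resources in the profile `x`. -/
def load (x : N → R → ℕ) (r : R) : ℕ := ∑ j, x j r

/-- The load that the players other than `i` cause in the profile `x`. -/
def others (x : N → R → ℕ) (i : N) (r : R) : ℕ := ∑ j ∈ Finset.univ.erase i, x j r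

theorem load_eq_others_add (x : N → R → ℕ) (i : N) : load x = others x i + x i :=
  funext fun _ => (Finset.sum_erase_add _ _ (Finset.mem_univ i)).symm

theorem others_update_self (x : N → R → ℕ) (i : N) (y : R → ℕ) :
    others (Function.update x i y) i = others x i := by
  ext r
  refine Finset.sum_congr rfl fun j hj => ?_
  rw [Function.update_of_ne (Finset.ne_of_mem_erase hj)]

theorem load_update (x : N → R → ℕ) (i : N) (y : R → ℕ) :
    load (Function.update x i y) = others x i + y := by
  rw [load_eq_others_add _ i, others_update_self, Function.update_self]

variable [DecidableEq R]

theorem load_update_addUnit (x : N → R → ℕ) (i : N) (z : R → ℕ) (r : R) :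
    load (Function.update x i (addUnit z r)) = addUnit (others x i + z) r := by
  rw [load_update, addUnit, addUnit, add_assoc]

theorem others_update_addUnit (x : N → R → ℕ) {i j : N} (hij : j ≠ i) (z : R → ℕ) (r : R) :
    others (Function.update x i (addUnit z r)) j =
      addUnit (others (Function.update x i z) j) r := by
  refine add_right_cancel (b := x j) ?_
  calc
    _ = load (Function.update x i (addUnit z r)) := by
      rw [load_eq_others_add _ j, Function.update_of_ne hij]
    _ = addUnit (load (Function.update x i z)) r := by rw [load_update_addUnit, load_update]
    _ = _ := by
      rw [load_eq_others_add _ j, Function.update_of_ne hij, addUnit, addUnit, add_right_comm]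

end Profiles

section Hamming

variable {R : Type*}

theorem inf_add_tsub (x y : R → ℕ) : x ⊓ y + (x - y) = x :=
  funext fun r => by simp only [Pi.add_apply, Pi.inf_apply, Pi.sub_apply]; omega

variable [Fintype R]

theorem hamming_eq_sum_tsub (x y : R → ℕ) :
    hamming x y = ∑ r, (x r - y r) + ∑ r, (y r - x r) := by
  rw [hamming, ← Finset.sum_add_distrib]
  exact Finset.sum_congr rfl fun r _ => by omega

theorem sum_add_sum_tsub_comm (x y : R → ℕ) :
    ∑ r, y r + ∑ r, (x r - y r) = ∑ r, x r + ∑ r, (y r - x r) := by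
  rw [← Finset.sum_add_distrib, ← Finset.sum_add_distrib]
  exact Finset.sum_congr rfl fun r _ => by omega

variable [DecidableEq R]

theorem exists_eq_addUnit_of_hamming_eq_one {x y : R → ℕ} (h : hamming y x = 1)
    (hsum : ∑ r, y r = ∑ r, x r + 1) : ∃ r, y = addUnit x r := by
  have hcomm := sum_add_sum_tsub_comm x y
  rw [hamming_eq_sum_tsub] at h
  obtain ⟨q, hq⟩ := exists_eq_single_of_sum_eq_one (x := y - x)
    (by simp only [Pi.sub_apply]; omega)
  have hle : ∀ r, x r - y r = 0 := fun r =>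
    Finset.sum_eq_zero_iff.1 (by omega : ∑ r, (x r - y r) = 0) r (Finset.mem_univ r)
  exact ⟨q, by rw [addUnit, ← hq, add_tsub_cancel_of_le fun r => Nat.sub_eq_zero_iff_le.1 (hle r)]⟩

theorem exists_eq_addUnit_of_hamming_eq_two {x y : R → ℕ} (h : hamming y x = 2)
    (hsum : ∑ r, y r = ∑ r, x r) : ∃ z p q, x = addUnit z p ∧ y = addUnit z q := by
  have hcomm := sum_add_sum_tsub_comm x y
  rw [hamming_eq_sum_tsub] at h
  obtain ⟨p, hp⟩ := exists_eq_single_of_sum_eq_one (x := x - y)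
    (by simp only [Pi.sub_apply]; omega)
  obtain ⟨q, hq⟩ := exists_eq_single_of_sum_eq_one (x := y - x)
    (by simp only [Pi.sub_apply]; omega)
  exact ⟨x ⊓ y, p, q, by rw [addUnit, ← hp, inf_add_tsub],
    by rw [addUnit, ← hq, inf_comm, inf_add_tsub]⟩

theorem hamming_addUnit_self (x : R → ℕ) (r : R) : hamming (addUnit x r) x = 1 := by
  simp [hamming_eq_sum_tsub, addUnit, Pi.single_apply]

theorem hamming_addUnit_addUnit (x : R → ℕ) {p q : R} (h : p ≠ q) :
    hamming (addUnit x p) (addUnit x q) = 2 := by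
  have hdiff : ∀ {p q : R}, p ≠ q → ∑ r, (addUnit x p r - addUnit x q r) = 1 := by
    intro p q h
    rw [Finset.sum_eq_single p _ (by simp), addUnit_self, addUnit_of_ne x h,
      Nat.add_sub_cancel_left]
    intro r _ hr
    rw [addUnit_of_ne x hr]
    exact Nat.sub_eq_zero_of_le (le_addUnit x q r)
  rw [hamming_eq_sum_tsub, hdiff h, hdiff h.symm]

end Hamming

section BestResponse

variable {N R : Type*} [Fintype R] [DecidableEq R] {G : PolymatroidGame N R} {i : N}

/-- The cost of player `i` on resource `r` when `i` puts `k` units there and the other players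
cause the load `a`. -/
def unitsCost (G : PolymatroidGame N R) (i : N) (a : R → ℕ) (r : R) (k : ℕ) : ℤ :=
  G.c i r (a r + k) * k

theorem unitsCost_succ_sub (i : N) (a : R → ℕ) (r : R) (k : ℕ) :
    G.unitsCost i a r (k + 1) - G.unitsCost i a r k = G.inc i r (a r + k) k := by
  simp [inc, unitsCost, add_assoc]

variable [Fintype N] [DecidableEq N] {e : N → ℕ} {x : N → R → ℕ}

theorem privateCost_update (G : PolymatroidGame N R) (x : N → R → ℕ) (i : N) (y : R → ℕ) :
    (G.privateCost (Function.update x i y) i : ℤ) = ∑ r, G.unitsCost i (others x i) r (y r) := by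
  have hload : ∀ r, ∑ j, Function.update x i y j r = others x i r + y r :=
    congrFun (load_update x i y)
  simp [privateCost, hload, unitsCost]

theorem isBestResponse_iff_optAt {y : R → ℕ} :
    G.IsBestResponse e x i y ↔ G.OptAt i (e i) (others x i) y := by
  unfold OptAt
  simp only [← unitsCost_succ_sub]
  refine ⟨fun ⟨hy, hmin⟩ => .of_forall_sum_le hy fun z hz => ?_, fun h => ⟨h.1, fun z hz => ?_⟩⟩
  · rw [← privateCost_update, ← privateCost_update]
    exact_mod_cast hmin z hz
  · have hle := h.sum_le (fun r k l hkl hl => ?_) hz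
    · rw [← privateCost_update, ← privateCost_update] at hle
      exact_mod_cast hle
    · rw [unitsCost_succ_sub, unitsCost_succ_sub]
      exact inc_mono le_rfl hkl hl

theorem canImprove_iff_not_optAt (hx : x i ∈ (G.f i).base (e i)) :
    G.CanImprove e x i ↔ ¬ G.OptAt i (e i) (others x i) (x i) := by
  rw [← isBestResponse_iff_optAt]
  simp [CanImprove, IsBestResponse, hx]

theorem privateCost_update_addUnit_lt_iff {z : R → ℕ} {p q : R} (hx : x i = addUnit z p) :
    G.privateCost (Function.update x i (addUnit z q)) i < G.privateCost x i ↔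
      G.marginalCost i (others x i) z q < G.marginalCost i (others x i) z p := by
  have hp := G.privateCost_update x i (addUnit z p)
  have hq := G.privateCost_update x i (addUnit z q)
  rw [sum_comp_addUnit, unitsCost_succ_sub] at hp hq
  rw [← hx, Function.update_eq_self] at hp
  zify
  rw [hp, hq]
  simp [marginalCost]

theorem exists_marginalCost_lt_of_canImprove (hx : x i ∈ (G.f i).base (e i))
    (hi : G.CanImprove e x i) :
    ∃ z p q, x i = addUnit z p ∧ addUnit z q ∈ (G.f i).base (e i) ∧
      G.marginalCost i (others x i) z q < G.marginalCost i (others x i) z p := by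
  rw [canImprove_iff_not_optAt hx] at hi
  by_contra! hcon
  exact hi ⟨hx, hcon⟩

end BestResponse

end PolymatroidGame

/-! ### The potential -/

namespace PolymatroidGame

section Potential

variable {N R : Type*} [Fintype R] [DecidableEq R] (G : PolymatroidGame N R)

/-- The rank of the increase `v` among the increases of player `i` at the loads `ℓ`: the number of
pairs of a resource and a number of units below `D` at which the increase is less than `v`. -/
def incRank (D : ℕ) (ℓ : R → ℕ) (i : N) (v : ℤ) : ℕ :=
  (Finset.univ.filter fun p : R × Fin D => G.inc i p.1 (ℓ p.1) p.2 < v).card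

/-- The sum of the ranks of the increases of the units that player `i` places in the strategy `x`,
at the loads `ℓ`. -/
def playerPotential (D : ℕ) (ℓ : R → ℕ) (i : N) (x : R → ℕ) : ℕ :=
  ∑ r, ∑ k ∈ Finset.range (x r), G.incRank D ℓ i (G.inc i r (ℓ r) k)

/-- The potential of the profile `x` at the loads `ℓ`: the sum of the ranks of the increases of all
units. -/
def potential [Fintype N] (D : ℕ) (ℓ : R → ℕ) (x : N → R → ℕ) : ℕ :=
  ∑ i, G.playerPotential D ℓ i (x i)

variable {G} {D : ℕ} {ℓ : R → ℕ} {i : N}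

theorem incRank_inc_lt {r : R} {k : ℕ} (hk : k < D) :
    G.incRank D ℓ i (G.inc i r (ℓ r) k) < Fintype.card R * D := by
  refine (Finset.card_lt_univ_of_notMem (x := (r, ⟨k, hk⟩)) ?_).trans_eq (by simp)
  simp

theorem incRank_inc_lt_incRank {v : ℤ} {r : R} {k : ℕ} (hk : k < D)
    (hv : G.inc i r (ℓ r) k < v) :
    G.incRank D ℓ i (G.inc i r (ℓ r) k) < G.incRank D ℓ i v := by
  refine Finset.card_lt_card ((Finset.ssubset_iff_of_subset ?_).2 ⟨(r, ⟨k, hk⟩), ?_, ?_⟩)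
  · exact Finset.monotone_filter_right _ fun p _ hp => hp.trans hv
  · simpa using hv
  · simp

theorem playerPotential_add_sum_le {x : R → ℕ} (hx : ∀ r, x r ≤ D) :
    G.playerPotential D ℓ i x + ∑ r, x r ≤ (∑ r, x r) * (Fintype.card R * D) := by
  rw [playerPotential, ← Finset.sum_add_distrib, Finset.sum_mul]
  refine Finset.sum_le_sum fun r _ => ?_
  calc
    _ = ∑ k ∈ Finset.range (x r), (G.incRank D ℓ i (G.inc i r (ℓ r) k) + 1) := by
      simp [Finset.sum_add_distrib]
    _ ≤ (Finset.range (x r)).card • (Fintype.card R * D) :=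
      Finset.sum_le_card_nsmul _ _ _ fun k hk =>
        incRank_inc_lt ((Finset.mem_range.1 hk).trans_le (hx r))
    _ = _ := by simp

theorem playerPotential_move_lt {z : R → ℕ} {r s : R} (hs : z s < D)
    (h : G.inc i s (ℓ s) (z s) < G.inc i r (ℓ r) (z r)) :
    G.playerPotential D ℓ i (addUnit z s) < G.playerPotential D ℓ i (addUnit z r) := by
  rw [playerPotential, playerPotential, sum_sum_range_addUnit, sum_sum_range_addUnit]
  exact Nat.add_lt_add_left (incRank_inc_lt_incRank hs h) _

variable [Fintype N] {x : N → R → ℕ}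

theorem potential_add_sum_le (hx : ∀ i r, x i r ≤ D) :
    G.potential D ℓ x + ∑ i, ∑ r, x i r ≤ (∑ i, ∑ r, x i r) * (Fintype.card R * D) := by
  rw [potential, ← Finset.sum_add_distrib, Finset.sum_mul]
  exact Finset.sum_le_sum fun i _ => playerPotential_add_sum_le (hx i)

theorem potential_move_lt [DecidableEq N] {z : R → ℕ} {r s : R} (hx : x i = addUnit z r)
    (hs : z s < D) (h : G.inc i s (ℓ s) (z s) < G.inc i r (ℓ r) (z r)) :
    G.potential D ℓ (Function.update x i (addUnit z s)) < G.potential D ℓ x := by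
  have hi := playerPotential_move_lt hs h
  refine Finset.sum_lt_sum (fun j _ => ?_) ⟨i, Finset.mem_univ i, ?_⟩
  · obtain rfl | hj := eq_or_ne j i
    · rw [Function.update_self, hx]
      exact hi.le
    · rw [Function.update_of_ne hj]
  · rwa [Function.update_self, hx]

end Potential

end PolymatroidGame

/-! ### Runs of the algorithm -/

namespace PolymatroidGame

open PolymatroidRank

section States

variable {N R : Type*} [DecidableEq N]

/-- The state after an iteration of the for-loop in which player `i` places a new unit on `r`. -/
def AlgState.insert [DecidableEq R] (s : AlgState N R) (i : N) (r : R) : AlgState N R :=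
  ⟨s.k + 1, Function.update s.demand i (s.demand i + 1),
    Function.update s.profile i (addUnit (s.profile i) r)⟩

/-- The state after an iteration of the while-loop in which player `i` chooses `y`. -/
def AlgState.move (s : AlgState N R) (i : N) (y : R → ℕ) : AlgState N R :=
  ⟨s.k, s.demand, Function.update s.profile i y⟩

end States

section Feasible

variable {N R : Type*} [Fintype N] [Fintype R] [DecidableEq R] {G : PolymatroidGame N R}
  {s : AlgState N R}

theorem sum_demand_le (G : PolymatroidGame N R) :
    ∑ i, G.demand i ≤ Fintype.card N * G.maxDemand :=
  Finset.sum_le_card_nsmul _ _ _ fun _ hi => Finset.le_sup hi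

theorem one_le_maxDemand [Nonempty N] (G : PolymatroidGame N R) : 1 ≤ G.maxDemand :=
  (G.demand_pos (Classical.arbitrary N)).trans (Finset.le_sup (Finset.mem_univ _))

/-- The preliminary strategies meet the preliminary demands, which are at most the demands and sum
up to the number of iterations of the for-loop. -/
structure Feasible (G : PolymatroidGame N R) (s : AlgState N R) : Prop where
  base : ∀ i, s.profile i ∈ (G.f i).base (s.demand i)
  le : ∀ i, s.demand i ≤ G.demand i
  sum : ∑ i, s.demand i = s.k

theorem feasible_init : G.Feasible (AlgState.init N R) where
  base i := by simp [PolymatroidRank.base, AlgState.init]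
  le i := Nat.zero_le _
  sum := by simp [AlgState.init]

theorem Feasible.profile_le (hF : G.Feasible s) (i : N) (r : R) : s.profile i r ≤ G.maxDemand :=
  calc
    s.profile i r ≤ ∑ r, s.profile i r :=
      Finset.single_le_sum (fun _ _ => Nat.zero_le _) (Finset.mem_univ r)
    _ = s.demand i := (hF.base i).2
    _ ≤ G.demand i := hF.le i
    _ ≤ G.maxDemand := Finset.le_sup (Finset.mem_univ i)

theorem Feasible.sum_sum_profile (hF : G.Feasible s) : ∑ i, ∑ r, s.profile i r = s.k := by
  rw [← hF.sum]
  exact Finset.sum_congr rfl fun i _ => (hF.base i).2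

theorem Feasible.k_le (hF : G.Feasible s) : s.k ≤ ∑ i, G.demand i :=
  hF.sum ▸ Finset.sum_le_sum fun i _ => hF.le i

end Feasible

variable {N R : Type*} [Fintype N] [DecidableEq N] [Fintype R] [DecidableEq R]
  {G : PolymatroidGame N R} {s s' : AlgState N R} {T : ℕ} {i : N} {z : R → ℕ} {p q r t : R}

theorem not_canImprove_init (i : N) :
    ¬ G.CanImprove (AlgState.init N R).demand (AlgState.init N R).profile i := by
  simp [CanImprove, privateCost, AlgState.init]

theorem Feasible.insert (hF : G.Feasible s) (hi : s.demand i < G.demand i)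
    (hr : addUnit (s.profile i) r ∈ (G.f i).base (s.demand i + 1)) : G.Feasible (s.insert i r) where
  base j := by
    obtain rfl | hj := eq_or_ne j i
    · simpa [AlgState.insert] using hr
    · simpa [AlgState.insert, hj] using hF.base j
  le j := by
    obtain rfl | hj := eq_or_ne j i
    · simpa [AlgState.insert] using hi
    · simpa [AlgState.insert, hj] using hF.le j
  sum := by
    simp only [AlgState.insert]
    rw [update_add_one_eq_addUnit, univ_sum_addUnit, hF.sum]

theorem Feasible.move (hF : G.Feasible s) {y : R → ℕ} (hy : y ∈ (G.f i).base (s.demand i)) :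
    G.Feasible (s.move i y) where
  base j := by
    obtain rfl | hj := eq_or_ne j i
    · simpa [AlgState.move] using hy
    · simpa [AlgState.move, hj] using hF.base j
  le := hF.le
  sum := hF.sum

theorem Feasible.optAt (hF : G.Feasible s) (hi : ¬ G.CanImprove s.demand s.profile i) :
    G.OptAt i (s.demand i) (others s.profile i) (s.profile i) := by
  rwa [canImprove_iff_not_optAt (hF.base i), not_not] at hi

theorem Feasible.isPureNash (hF : G.Feasible s)
    (hopt : ∀ i, ¬ G.CanImprove s.demand s.profile i) (hk : s.k = ∑ i, G.demand i) :
    G.IsPureNash s.profile := by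
  have hd : s.demand = G.demand := funext fun i =>
    (Finset.sum_eq_sum_iff_of_le fun j _ => hF.le j).1 (hF.sum.trans hk) i (Finset.mem_univ i)
  intro i
  rw [isBestResponse_iff_optAt, ← hd]
  exact hF.optAt (hopt i)

/-- Every player is at a best response to the others with one unit less on `r`: `r` is the resource
that received the latest unit. -/
def Marked (G : PolymatroidGame N R) (s : AlgState N R) (r : R) : Prop :=
  ∀ i, G.OptAt i (s.demand i) (subUnit (others s.profile i) r) (s.profile i)

theorem marked_insert (hF : G.Feasible s) (hopt : ∀ j, ¬ G.CanImprove s.demand s.profile j)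
    (hr : G.OptAt i (s.demand i + 1) (others s.profile i) (addUnit (s.profile i) r)) :
    G.Marked (s.insert i r) r := by
  intro j
  simp only [AlgState.insert]
  obtain rfl | hj := eq_or_ne j i
  · have hx := hF.optAt (hopt j)
    simp only [Function.update_self, others_update_self]
    obtain h | ⟨a, ha⟩ := subUnit_eq_self_or_exists_eq_addUnit (others s.profile j) r
    · rwa [h]
    · rw [ha] at hx hr ⊢
      rw [subUnit_addUnit]
      exact hx.of_insert hr
  · rw [Function.update_of_ne hj, Function.update_of_ne hj, others_update_addUnit _ hj,
      Function.update_eq_self, subUnit_addUnit]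
    exact hF.optAt (hopt j)

/-- Only the marked resource got more expensive, so every improving exchange removes a unit from
it. -/
theorem Marked.eq_of_lt (h : G.Marked s r) (hz : s.profile i = addUnit z p)
    (hq : addUnit z q ∈ (G.f i).base (s.demand i))
    (hlt : G.marginalCost i (others s.profile i) z q <
      G.marginalCost i (others s.profile i) z p) : p = r := by
  by_contra hpr
  refine hlt.not_ge ?_
  calc
    _ = G.marginalCost i (subUnit (others s.profile i) r) z p :=
      marginalCost_congr (subUnit_of_ne _ hpr).symm rfl
    _ ≤ G.marginalCost i (subUnit (others s.profile i) r) z q :=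
      OptAt.marginalCost_le (hz ▸ h i) hq
    _ ≤ _ := marginalCost_mono (Nat.sub_le _ _) le_rfl (add_one_le_rank_of_addUnit_mem_base hq)

theorem Marked.exists_others_eq_addUnit (h : G.Marked s r) (hz : s.profile i = addUnit z r)
    (hq : addUnit z q ∈ (G.f i).base (s.demand i))
    (hlt : G.marginalCost i (others s.profile i) z q <
      G.marginalCost i (others s.profile i) z r) :
    ∃ a, others s.profile i = addUnit a r ∧ G.OptAt i (s.demand i) a (addUnit z r) := by
  have hi := hz ▸ h i
  obtain heq | ⟨a, ha⟩ := subUnit_eq_self_or_exists_eq_addUnit (others s.profile i) r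
  · rw [heq] at hi
    exact absurd (hi.marginalCost_le hq) hlt.not_ge
  · rw [ha, subUnit_addUnit] at hi
    exact ⟨a, ha, hi⟩

theorem Marked.optAt_of_isCheapestUnit (h : G.Marked s r) (hz : s.profile i = addUnit z r)
    (ht : G.IsCheapestUnit i (s.demand i) (others s.profile i) z t)
    (hlt : G.marginalCost i (others s.profile i) z t <
      G.marginalCost i (others s.profile i) z r) :
    G.OptAt i (s.demand i) (others s.profile i) (addUnit z t) := by
  obtain ⟨a, ha, hi⟩ := h.exists_others_eq_addUnit hz ht.1 hlt
  rw [ha] at ht ⊢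
  exact hi.reinsert ht

theorem Marked.move (h : G.Marked s r) (hz : s.profile i = addUnit z r)
    (ht : G.OptAt i (s.demand i) (others s.profile i) (addUnit z t))
    (hlt : G.marginalCost i (others s.profile i) z t <
      G.marginalCost i (others s.profile i) z r) : G.Marked (s.move i (addUnit z t)) t := by
  intro j
  simp only [AlgState.move]
  obtain rfl | hj := eq_or_ne j i
  · obtain ⟨a, ha, hi⟩ := h.exists_others_eq_addUnit hz ht.1 hlt
    simp only [Function.update_self, others_update_self]
    obtain heq | ⟨b, hb⟩ := subUnit_eq_self_or_exists_eq_addUnit (others s.profile j) t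
    · rwa [heq]
    · rw [hb, subUnit_addUnit]
      exact hi.of_move (ha ▸ ht) (ha.symm.trans hb)
  · have hold : s.profile = Function.update s.profile i (addUnit z r) := by
      rw [← hz, Function.update_eq_self]
    have hj' := h j
    rw [hold, others_update_addUnit _ hj, subUnit_addUnit] at hj'
    rw [others_update_addUnit _ hj, subUnit_addUnit]
    simpa only [Function.update_of_ne hj] using hj'

/-- While the marked resource moves, the loads without the marked unit stay fixed. Hence every
iteration of the while-loop lowers the potential at these loads, and every iteration of the for-loop
makes room for a new potential. -/
def TimeInv (G : PolymatroidGame N R) (T : ℕ) (s : AlgState N R) : Prop :=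
  (s = AlgState.init N R ∧ T = 0) ∨ ∃ r ℓ, G.Marked s r ∧ load s.profile = addUnit ℓ r ∧
    T + G.potential G.maxDemand ℓ s.profile ≤
      s.k * ((∑ i, G.demand i) * (Fintype.card R * G.maxDemand))

theorem TimeInv.le (hT : G.TimeInv T s) :
    T ≤ s.k * ((∑ i, G.demand i) * (Fintype.card R * G.maxDemand)) := by
  obtain ⟨-, rfl⟩ | ⟨_, _, -, -, h⟩ := hT
  · exact Nat.zero_le _
  · exact le_of_add_le_left h

theorem TimeInv.insert (hT : G.TimeInv T s) (hF : G.Feasible (s.insert i r))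
    (hr : G.Marked (s.insert i r) r) : G.TimeInv (T + 1) (s.insert i r) := by
  refine Or.inr ⟨r, others s.profile i + s.profile i, hr, load_update_addUnit .., ?_⟩
  have hpot := potential_add_sum_le (G := G) (ℓ := others s.profile i + s.profile i) hF.profile_le
  rw [hF.sum_sum_profile] at hpot
  have hk : (s.insert i r).k = s.k + 1 := rfl
  have hunits := Nat.mul_le_mul_right (Fintype.card R * G.maxDemand) hF.k_le
  have hT := hT.le
  rw [hk] at hpot hunits ⊢
  rw [Nat.succ_mul s.k]
  omega

theorem TimeInv.move (hT : G.TimeInv T s) (hF : G.Feasible s)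
    (hi : G.CanImprove s.demand s.profile i) (hz : s.profile i = addUnit z p)
    (ht : G.OptAt i (s.demand i) (others s.profile i) (addUnit z t))
    (hlt : G.marginalCost i (others s.profile i) z t <
      G.marginalCost i (others s.profile i) z p) : G.TimeInv (T + 1) (s.move i (addUnit z t)) := by
  obtain ⟨rfl, -⟩ | ⟨r, ℓ, hr, hℓ, hT⟩ := hT
  · exact absurd hi (not_canImprove_init i)
  obtain rfl := hr.eq_of_lt hz ht.1 hlt
  obtain rfl : others s.profile i + z = ℓ := by
    refine addUnit_injective p (Eq.trans ?_ hℓ)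
    simp only [load_eq_others_add _ i, hz, addUnit, add_assoc]
  refine Or.inr ⟨t, _, hr.move hz ht hlt, load_update_addUnit .., ?_⟩
  have hzt : z t < G.maxDemand := by
    have h := (hF.move ht.1).profile_le i t
    simp only [AlgState.move, Function.update_self, addUnit_self] at h
    exact h
  have hpot : G.potential G.maxDemand (others s.profile i + z) (s.move i (addUnit z t)).profile <
      G.potential G.maxDemand (others s.profile i + z) s.profile := potential_move_lt hz hzt hlt
  have hk : (s.move i (addUnit z t)).k = s.k := rfl
  rw [hk]
  omega

theorem AlgStep.inv (h : G.AlgStep s s') (hF : G.Feasible s) (hT : G.TimeInv T s) :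
    G.Feasible s' ∧ G.TimeInv (T + 1) s' := by
  cases h with
  | forStep i y hk hexit hi hy hd =>
    rw [isBestResponse_iff_optAt, Function.update_self] at hy
    obtain ⟨r, rfl⟩ := exists_eq_addUnit_of_hamming_eq_one hd (by rw [hy.1.2, (hF.base i).2])
    have hF' := hF.insert hi hy.1
    exact ⟨hF', hT.insert hF' (marked_insert hF (not_exists.1 hexit) hy)⟩
  | whileStep i y hi hy hd =>
    obtain ⟨w, hw, hwlt⟩ := hi
    have hlt := (hy.2 w hw).trans_lt hwlt
    rw [isBestResponse_iff_optAt] at hy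
    obtain ⟨z, p, t, hz, rfl⟩ :=
      exists_eq_addUnit_of_hamming_eq_two hd (by rw [hy.1.2, (hF.base i).2])
    rw [privateCost_update_addUnit_lt_iff hz] at hlt
    exact ⟨hF.move hy.1, hT.move hF ⟨w, hw, hwlt⟩ hz hy hlt⟩

theorem AlgRun.inv (h : G.AlgRun T s) : G.Feasible s ∧ G.TimeInv T s := by
  induction h with
  | start => exact ⟨feasible_init, Or.inl ⟨rfl, rfl⟩⟩
  | step _ h' ih => exact h'.inv ih.1 ih.2

theorem AlgRun.le_sq_mul_mul_cube (h : G.AlgRun T s) :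
    T ≤ Fintype.card N ^ 2 * Fintype.card R * G.maxDemand ^ 3 := by
  obtain ⟨hF, hT⟩ := h.inv
  calc
    T ≤ s.k * ((∑ i, G.demand i) * (Fintype.card R * G.maxDemand)) := hT.le
    _ ≤ (Fintype.card N * G.maxDemand) * ((Fintype.card N * G.maxDemand) *
        (Fintype.card R * G.maxDemand)) := by
      gcongr
      · exact hF.k_le.trans G.sum_demand_le
      · exact G.sum_demand_le
    _ = _ := by ring

theorem AlgRun.le [Nonempty N] [Nonempty R] (h : G.AlgRun T s) :
    T ≤ Fintype.card N ^ (G.maxDemand + 1) * Fintype.card R ^ G.maxDemand *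
      G.maxDemand ^ (G.maxDemand + 1) := by
  have hN : 1 ≤ Fintype.card N := Fintype.card_pos
  have hD := G.one_le_maxDemand
  refine h.le_sq_mul_mul_cube.trans ?_
  obtain hD1 | hD2 := hD.eq_or_lt
  · simp [← hD1]
  · exact Nat.mul_le_mul (Nat.mul_le_mul (Nat.pow_le_pow_right hN (by omega))
      (Nat.le_self_pow (by omega) _)) (Nat.pow_le_pow_right hD (by omega))

theorem algStep_insert (hF : G.Feasible s) (hopt : ∀ j, ¬ G.CanImprove s.demand s.profile j)
    (hi : s.demand i < G.demand i)
    (hr : G.IsCheapestUnit i (s.demand i + 1) (others s.profile i) (s.profile i) r) :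
    G.AlgStep s (s.insert i r) ∧ G.Marked (s.insert i r) r := by
  have hy := (hF.optAt (hopt i)).insert hr
  refine ⟨.forStep s i _ ?_ (not_exists.2 hopt) hi ?_ (hamming_addUnit_self _ _),
    marked_insert hF hopt hy⟩
  · rw [← hF.sum]
    exact Finset.sum_lt_sum (fun j _ => hF.le j) ⟨i, Finset.mem_univ i, hi⟩
  · rwa [isBestResponse_iff_optAt, Function.update_self]

theorem Marked.algStep_move (h : G.Marked s r) (hz : s.profile i = addUnit z r)
    (ht : G.IsCheapestUnit i (s.demand i) (others s.profile i) z t)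
    (hlt : G.marginalCost i (others s.profile i) z t <
      G.marginalCost i (others s.profile i) z r) :
    G.AlgStep s (s.move i (addUnit z t)) ∧ G.Marked (s.move i (addUnit z t)) t := by
  have hy := h.optAt_of_isCheapestUnit hz ht hlt
  refine ⟨.whileStep s i _ ⟨_, ht.1, (privateCost_update_addUnit_lt_iff hz).2 hlt⟩
    (isBestResponse_iff_optAt.2 hy) ?_, h.move hz hy hlt⟩
  rw [hz]
  refine hamming_addUnit_addUnit z ?_
  rintro rfl
  exact hlt.false

theorem Marked.exists_of_canImprove (h : G.Marked s r) (hF : G.Feasible s)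
    (hi : G.CanImprove s.demand s.profile i) :
    ∃ z q, s.profile i = addUnit z r ∧ addUnit z q ∈ (G.f i).base (s.demand i) ∧
      G.marginalCost i (others s.profile i) z q < G.marginalCost i (others s.profile i) z r := by
  obtain ⟨z, p, q, hz, hq, hlt⟩ := exists_marginalCost_lt_of_canImprove (hF.base i) hi
  obtain rfl := h.eq_of_lt hz hq hlt
  exact ⟨z, q, hz, hq, hlt⟩

theorem exists_algStep_of_canImprove (hF : G.Feasible s) (hT : G.TimeInv T s)
    (hi : G.CanImprove s.demand s.profile i) : ∃ s', G.AlgStep s s' := by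
  obtain ⟨rfl, -⟩ | ⟨r, -, hr, -⟩ := hT
  · exact absurd hi (not_canImprove_init i)
  obtain ⟨z, q, hz, hq, hlt⟩ := hr.exists_of_canImprove hF hi
  obtain ⟨t, ht⟩ := exists_isCheapestUnit (a := others s.profile i) hq
  exact ⟨_, (hr.algStep_move hz ht ((ht.2 q hq).trans_lt hlt)).1⟩

theorem exists_algStep_of_k_lt (hF : G.Feasible s)
    (hopt : ∀ j, ¬ G.CanImprove s.demand s.profile j) (hk : s.k < ∑ i, G.demand i) :
    ∃ s', G.AlgStep s s' := by
  rw [← hF.sum] at hk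
  obtain ⟨i, -, hi⟩ := Finset.exists_lt_of_sum_lt hk
  obtain ⟨q, hq⟩ := exists_addUnit_mem_base (hF.base i) (hi.trans_le (G.demand_le i))
  obtain ⟨r, hr⟩ := exists_isCheapestUnit (a := others s.profile i) hq
  exact ⟨_, (algStep_insert hF hopt hi hr).1⟩

theorem AlgRun.progress (h : G.AlgRun T s) :
    (G.AlgReturns s ∧ G.IsPureNash s.profile) ∨
      (¬ G.AlgReturns s ∧ ∃ s', G.AlgStep s s') := by
  obtain ⟨hF, hT⟩ := h.inv
  by_cases himprove : ∃ j, G.CanImprove s.demand s.profile j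
  · obtain ⟨i, hi⟩ := himprove
    exact Or.inr ⟨fun hret => hret.2 ⟨i, hi⟩, exists_algStep_of_canImprove hF hT hi⟩
  · have hopt := not_exists.1 himprove
    obtain hk | hk := hF.k_le.eq_or_lt
    · exact Or.inl ⟨⟨hk, himprove⟩, hF.isPureNash hopt hk⟩
    · exact Or.inr ⟨fun hret => hk.ne hret.1, exists_algStep_of_k_lt hF hopt hk⟩

end PolymatroidGame

/-! ### Running times of random access machine programs -/

section

variable {n m : ℕ} {G : PolymatroidGame (Fin n) (Fin m)}

variable (G) in
/-- All cost queries that are made when the expression is evaluated are at loads that do not exceed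
the total demand. Only the answers to these queries are bounded in terms of `maxBits`. -/
def RamExpr.Safe (μ : RamMem) : RamExpr → Prop
  | .lit _ => True
  | .get _ j => j.Safe μ
  | .add e₁ e₂ => e₁.Safe μ ∧ e₂.Safe μ
  | .sub e₁ e₂ => e₁.Safe μ ∧ e₂.Safe μ
  | .mul e₁ e₂ => e₁.Safe μ ∧ e₂.Safe μ
  | .rank i _ => i.Safe μ
  | .cost i r x => (i.Safe μ ∧ r.Safe μ ∧ x.Safe μ) ∧ x.val G μ ≤ ∑ j, G.demand j

/-- A measure for the size of an expression that also bounds its literals. -/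
def RamExpr.weight : RamExpr → ℕ
  | .lit v => v + 1
  | .get _ j => j.weight + 1
  | .add e₁ e₂ => e₁.weight + e₂.weight + 1
  | .sub e₁ e₂ => e₁.weight + e₂.weight + 1
  | .mul e₁ e₂ => e₁.weight + e₂.weight + 1
  | .rank i _ => i.weight + 1
  | .cost i r x => i.weight + r.weight + x.weight + 1

/-- An upper bound for the bit length of the value of an expression, when the memory and the
answers of the oracles have at most `B` bits. -/
def RamExpr.bits (B : ℕ) : RamExpr → ℕ
  | .lit v => v
  | .get _ _ => B
  | .add e₁ e₂ => max (e₁.bits B) (e₂.bits B) + 1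
  | .sub e₁ _ => e₁.bits B
  | .mul e₁ e₂ => e₁.bits B + e₂.bits B
  | .rank _ _ => B
  | .cost _ _ _ => B

/-- The value of the expression is computed without multiplication, except in addresses and in the
arguments of oracle queries. -/
def RamExpr.Additive : RamExpr → Prop
  | .add e₁ e₂ => e₁.Additive ∧ e₂.Additive
  | .sub e₁ e₂ => e₁.Additive ∧ e₂.Additive
  | .mul _ _ => False
  | _ => True

/-- An upper bound for the weights of the expressions in a program. -/
def RamProg.weight : RamProg → ℕ
  | .skip => 0
  | .assign _ j e => j.weight + e.weight
  | .seq p q => p.weight + q.weight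
  | .ite e p q => e.weight + p.weight + q.weight
  | .loop e p => e.weight + p.weight

/-- All values that the program stores are computed without multiplication, so that every
assignment lengthens the stored numbers by a constant number of bits only. -/
def RamProg.Additive : RamProg → Prop
  | .skip => True
  | .assign _ _ e => e.Additive
  | .seq p q => p.Additive ∧ q.Additive
  | .ite _ p q => p.Additive ∧ q.Additive
  | .loop _ p => p.Additive

/-- The arrays that a program may modify. -/
def RamProg.writes : RamProg → List ℕ
  | .skip => []
  | .assign a _ _ => [a]
  | .seq p q => p.writes ++ q.writes
  | .ite _ p q => p.writes ++ q.writes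
  | .loop _ p => p.writes

/-- All entries of the memory have at most `B` bits. -/
def RamMem.Bounded (μ : RamMem) (B : ℕ) : Prop := ∀ a j, μ a j < 2 ^ B

@[simp] theorem RamMem.write_self (μ : RamMem) (a j v : ℕ) :
    μ.write a j v a = Function.update (μ a) j v := Function.update_self _ _ _

@[simp] theorem RamMem.write_of_ne (μ : RamMem) {a b : ℕ} (j v : ℕ) (h : b ≠ a) :
    μ.write a j v b = μ b := Function.update_of_ne h _ _

theorem RamMem.Bounded.mono {μ : RamMem} {B C : ℕ} (h : μ.Bounded B) (hBC : B ≤ C) :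
    μ.Bounded C :=
  fun a j => (h a j).trans_le (Nat.pow_le_pow_right two_pos hBC)

theorem RamMem.Bounded.write {μ : RamMem} {B : ℕ} (h : μ.Bounded B) {a j v : ℕ}
    (hv : v < 2 ^ B) : (μ.write a j v).Bounded B := by
  intro b k
  by_cases hb : b = a
  · subst hb
    rw [write_self, Function.update_apply]
    split_ifs
    exacts [hv, h _ _]
  · rw [write_of_ne _ _ _ hb]
    exact h _ _

variable (G) in
theorem rankOracle_lt (i : ℕ) (A : ℕ → ℕ) : rankOracle G i A < 2 ^ G.maxBits := by
  unfold rankOracle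
  split_ifs with h
  · rw [← Nat.size_le]
    refine le_trans ?_ ((Finset.le_sup (Finset.mem_univ (⟨i, h⟩ : Fin n))).trans (le_max_left _ _))
    exact Finset.le_sup (f := fun U : Finset (Fin m) => Nat.size ((G.f ⟨i, h⟩).rank U))
      (Finset.mem_univ _)
  · positivity

theorem costOracle_lt (i r : ℕ) {x : ℕ} (hx : x ≤ ∑ j, G.demand j) :
    costOracle G i r x < 2 ^ G.maxBits := by
  unfold costOracle
  split_ifs with h
  · rw [← Nat.size_le]
    refine le_trans ?_ (le_max_right _ _)
    refine le_trans ?_ (Finset.le_sup (Finset.mem_univ (⟨i, h.1⟩ : Fin n)))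
    refine le_trans ?_ (Finset.le_sup (Finset.mem_univ (⟨r, h.2⟩ : Fin m)))
    exact Finset.le_sup (f := fun x => Nat.size (G.c ⟨i, h.1⟩ ⟨r, h.2⟩ x))
      (Finset.mem_range_succ_iff.2 hx)
  · positivity

theorem RamExpr.val_lt_two_pow_bits {μ : RamMem} {B : ℕ} (hB : G.maxBits ≤ B) (hμ : μ.Bounded B)
    (e : RamExpr) (he : e.Safe G μ) : e.val G μ < 2 ^ e.bits B := by
  induction e with
  | lit v => exact Nat.lt_two_pow_self
  | get a j => exact hμ a _
  | add e₁ e₂ ih₁ ih₂ =>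
    have h₁ := (ih₁ he.1).trans_le (Nat.pow_le_pow_right two_pos (le_max_left _ (e₂.bits B)))
    have h₂ := (ih₂ he.2).trans_le (Nat.pow_le_pow_right two_pos (le_max_right (e₁.bits B) _))
    rw [bits, val, pow_succ]
    omega
  | sub e₁ e₂ ih₁ => exact (Nat.sub_le _ _).trans_lt (ih₁ he.1)
  | mul e₁ e₂ ih₁ ih₂ =>
    rw [bits, val, pow_add]
    exact Nat.mul_lt_mul'' (ih₁ he.1) (ih₂ he.2)
  | rank i a => exact (rankOracle_lt G _ _).trans_le (Nat.pow_le_pow_right two_pos hB)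
  | cost i r x => exact (costOracle_lt _ _ he.2).trans_le (Nat.pow_le_pow_right two_pos hB)

theorem RamExpr.bits_le_mul_weight {B : ℕ} (hB : 1 ≤ B) (e : RamExpr) :
    e.bits B ≤ B * e.weight := by
  induction e with
  | lit v => exact v.le_succ.trans (Nat.le_mul_of_pos_left _ hB)
  | get | rank | cost => exact Nat.le_mul_of_pos_right _ (Nat.succ_pos _)
  | add e₁ e₂ | sub e₁ e₂ | mul e₁ e₂ =>
    simp only [bits, weight, Nat.mul_add]
    omega

theorem RamExpr.Additive.bits_le {B : ℕ} {e : RamExpr} (he : e.Additive) :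
    e.bits B ≤ B + e.weight := by
  induction e with
  | lit v => simp only [bits, weight]; omega
  | get | rank | cost => exact Nat.le_add_right _ _
  | add e₁ e₂ ih₁ ih₂ | sub e₁ e₂ ih₁ ih₂ =>
    have h₁ := ih₁ he.1
    have h₂ := ih₂ he.2
    simp only [bits, weight]
    omega
  | mul => exact he.elim

theorem RamExpr.time_le {μ : RamMem} {B W : ℕ} (hB : G.maxBits ≤ B) (hB1 : 1 ≤ B)
    (hμ : μ.Bounded B) {e : RamExpr} (he : e.Safe G μ) (hW : e.weight ≤ W) :
    e.time G μ ≤ e.weight * (1 + m + B * W) := by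
  have hsize (e : RamExpr) (he : e.Safe G μ) (hW : e.weight ≤ W) : Nat.size (e.val G μ) ≤ B * W :=
    Nat.size_le.2 <| (e.val_lt_two_pow_bits hB hμ he).trans_le <| Nat.pow_le_pow_right two_pos <|
      (e.bits_le_mul_weight hB1).trans (Nat.mul_le_mul_left B hW)
  have hval := hsize e he hW
  induction e with
  | lit v =>
    rw [val] at hval
    simp only [time, weight, Nat.add_mul]
    omega
  | get a j ih | rank j a ih =>
    simp only [weight] at hW
    have := ih he (by omega) (hsize _ he (by omega))
    simp only [time, weight, Nat.add_mul]
    omega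
  | add e₁ e₂ ih₁ ih₂ | sub e₁ e₂ ih₁ ih₂ | mul e₁ e₂ ih₁ ih₂ =>
    simp only [weight] at hW
    have := ih₁ he.1 (by omega) (hsize _ he.1 (by omega))
    have := ih₂ he.2 (by omega) (hsize _ he.2 (by omega))
    simp only [time, weight, Nat.add_mul]
    omega
  | cost i r x ih₁ ih₂ ih₃ =>
    simp only [weight] at hW
    have := ih₁ he.1.1 (by omega) (hsize _ he.1.1 (by omega))
    have := ih₂ he.1.2.1 (by omega) (hsize _ he.1.2.1 (by omega))
    have := ih₃ he.1.2.2 (by omega) (hsize _ he.1.2.2 (by omega))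
    simp only [time, weight, Nat.add_mul]
    omega

variable (G) in
/-- `RamRuns G p μ s μ'`: the program `p` started in memory `μ` halts after `s` instructions in
memory `μ'`, and all cost queries are at loads that do not exceed the total demand. -/
inductive RamRuns : RamProg → RamMem → ℕ → RamMem → Prop
  | skip (μ : RamMem) : RamRuns .skip μ 1 μ
  | assign {μ : RamMem} {a : ℕ} {j e : RamExpr} (hj : j.Safe G μ) (he : e.Safe G μ) :
      RamRuns (.assign a j e) μ 1 (μ.write a (j.val G μ) (e.val G μ))
  | seq {p q : RamProg} {μ μ' μ'' : RamMem} {s s' : ℕ}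
      (h : RamRuns p μ s μ') (h' : RamRuns q μ' s' μ'') :
      RamRuns (.seq p q) μ (s + s' + 1) μ''
  | ite_true {e : RamExpr} {p q : RamProg} {μ μ' : RamMem} {s : ℕ} (hs : e.Safe G μ)
      (he : e.val G μ ≠ 0) (h : RamRuns p μ s μ') : RamRuns (.ite e p q) μ (s + 1) μ'
  | ite_false {e : RamExpr} {p q : RamProg} {μ μ' : RamMem} {s : ℕ} (hs : e.Safe G μ)
      (he : e.val G μ = 0) (h : RamRuns q μ s μ') : RamRuns (.ite e p q) μ (s + 1) μ'
  | loop_true {e : RamExpr} {p : RamProg} {μ μ' μ'' : RamMem} {s s' : ℕ} (hs : e.Safe G μ)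
      (he : e.val G μ ≠ 0) (h : RamRuns p μ s μ') (h' : RamRuns (.loop e p) μ' s' μ'') :
      RamRuns (.loop e p) μ (s + s' + 1) μ''
  | loop_false {e : RamExpr} {p : RamProg} {μ : RamMem} (hs : e.Safe G μ)
      (he : e.val G μ = 0) : RamRuns (.loop e p) μ 1 μ

theorem RamRuns.frame {p : RamProg} {μ μ' : RamMem} {s : ℕ} (h : RamRuns G p μ s μ') {a : ℕ}
    (ha : a ∉ p.writes) : μ' a = μ a := by
  induction h with
  | skip | loop_false => rfl
  | assign => exact Function.update_of_ne (List.mem_singleton.not.1 ha) _ _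
  | seq _ _ ih ih' =>
    simp only [RamProg.writes, List.mem_append, not_or] at ha
    rw [ih' ha.2, ih ha.1]
  | ite_true _ _ _ ih | ite_false _ _ _ ih =>
    simp only [RamProg.writes, List.mem_append, not_or] at ha
    exact ih (by tauto)
  | loop_true _ _ _ _ ih ih' => rw [ih' ha, ih ha]

theorem RamRuns.bounded {p : RamProg} {μ μ' : RamMem} {s W B : ℕ} (h : RamRuns G p μ s μ')
    (ha : p.Additive) (hW : p.weight ≤ W) (hB : G.maxBits ≤ B) (hμ : μ.Bounded B) :
    μ'.Bounded (B + s * W) := by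
  induction h generalizing B with
  | skip | loop_false => exact hμ.mono (Nat.le_add_right _ _)
  | @assign μ a j e _ he =>
    refine (hμ.mono (Nat.le_add_right _ _)).write <|
      (e.val_lt_two_pow_bits hB hμ he).trans_le <| Nat.pow_le_pow_right two_pos ?_
    have : e.bits B ≤ B + e.weight := RamExpr.Additive.bits_le ha
    simp only [RamProg.weight] at hW
    omega
  | @seq p q _ _ _ s s' _ _ ih ih' =>
    simp only [RamProg.weight] at hW
    have := ih ha.1 (by omega) hB hμ
    refine (ih' ha.2 (by omega) (by omega) this).mono ?_
    simp only [Nat.add_mul]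
    omega
  | ite_true _ _ _ ih | ite_false _ _ _ ih =>
    simp only [RamProg.weight] at hW
    refine RamMem.Bounded.mono (ih ?_ (by omega) hB hμ) ?_
    · first | exact ha.1 | exact ha.2
    · simp only [Nat.add_mul]
      omega
  | loop_true _ _ _ _ ih ih' =>
    have := ih ha (le_trans (Nat.le_add_left _ _) hW) hB hμ
    refine (ih' ha hW (by omega) this).mono ?_
    simp only [Nat.add_mul]
    omega

/-- Additive programs keep the numbers short, so that counting instructions suffices for bounding
the running time at logarithmic cost. -/
theorem RamRuns.exists_exec {p : RamProg} {μ μ' : RamMem} {s W B C : ℕ} (h : RamRuns G p μ s μ')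
    (ha : p.Additive) (hW : p.weight ≤ W) (hB : G.maxBits ≤ B) (hB1 : 1 ≤ B) (hμ : μ.Bounded B)
    (hC : B + s * W ≤ C) :
    ∃ t ≤ s * (W * (1 + m + C * W) + 1), RamExec G p μ t μ' := by
  have htime (e : RamExpr) (ν : RamMem) (he : e.Safe G ν) (hν : ν.Bounded C) (hw : e.weight ≤ W) :
      e.time G ν ≤ e.weight * (1 + m + C * W) := e.time_le (by omega) (by omega) hν he hw
  generalize 1 + m + C * W = K at *
  have htest {e : RamExpr} {ν : RamMem} (he : e.Safe G ν) (hν : ν.Bounded C) (hw : e.weight ≤ W) :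
      e.time G ν ≤ W * K := (htime e ν he hν hw).trans (Nat.mul_le_mul_right K hw)
  induction h generalizing B with
  | skip μ => exact ⟨1, by nlinarith [Nat.zero_le (W * K)], .skip μ⟩
  | @assign μ a j e hj he =>
    simp only [RamProg.weight] at hW
    have hνC := hμ.mono ((Nat.le_add_right _ _).trans hC)
    have := htime j μ hj hνC (by omega)
    have := htime e μ he hνC (by omega)
    have := Nat.mul_le_mul_right K hW
    rw [Nat.add_mul] at this
    exact ⟨_, by omega, .assign μ a j e⟩
  | @seq p q μ _ _ s s' h _ ih ih' =>
    simp only [RamProg.weight, Nat.add_mul] at hW hC ⊢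
    obtain ⟨t, ht, hexec⟩ := ih ha.1 (by omega) hB hB1 hμ (by omega)
    obtain ⟨t', ht', hexec'⟩ := ih' ha.2 (by omega) (by omega) (by omega)
      (h.bounded (W := W) ha.1 (by omega) hB hμ) (by omega)
    exact ⟨_, by omega, .seq hexec hexec'⟩
  | ite_true hs he _ ih | ite_false hs he _ ih =>
    simp only [RamProg.weight, Nat.add_mul] at hW hC ⊢
    obtain ⟨t, ht, hexec⟩ := ih (by first | exact ha.1 | exact ha.2) (by omega) hB hB1 hμ (by omega)
    have := htest hs (hμ.mono (by omega)) (by omega)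
    first
    | exact ⟨_, by omega, .ite_true he hexec⟩
    | exact ⟨_, by omega, .ite_false he hexec⟩
  | @loop_true e p μ _ _ s s' hs he h _ ih ih' =>
    have hW' : e.weight + p.weight ≤ W := hW
    simp only [Nat.add_mul] at hC ⊢
    obtain ⟨t, ht, hexec⟩ := ih ha (by omega) hB hB1 hμ (by omega)
    obtain ⟨t', ht', hexec'⟩ := ih' ha hW (by omega) (by omega)
      (h.bounded (W := W) ha (le_trans (Nat.le_add_left _ _) hW) hB hμ) (by omega)
    have := htest hs (hμ.mono (by omega)) (by omega)
    exact ⟨_, by omega, .loop_true he hexec hexec'⟩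
  | @loop_false e p μ hs he =>
    simp only [RamProg.weight] at hW
    have := htest hs (hμ.mono (by omega)) (by omega)
    exact ⟨_, by omega, .loop_false he⟩

namespace RamProg

/-- Total correctness: the program `p` started in memory `μ` halts after at most `b` instructions,
all cost queries are at loads that do not exceed the total demand, and `Q` holds for the final
memory. -/
def HaltsWithin (G : PolymatroidGame (Fin n) (Fin m)) (p : RamProg) (μ : RamMem) (b : ℕ)
    (Q : RamMem → Prop) : Prop :=
  ∃ s ≤ b, ∃ μ', RamRuns G p μ s μ' ∧ Q μ'

namespace HaltsWithin

variable {p q : RamProg} {μ : RamMem} {a b : ℕ} {j e : RamExpr} {Q : RamMem → Prop}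

theorem mono {b' : ℕ} {Q' : RamMem → Prop} (h : p.HaltsWithin G μ b Q) (hb : b ≤ b')
    (hQ : ∀ ν, (∀ a ∉ p.writes, ν a = μ a) → Q ν → Q' ν) : p.HaltsWithin G μ b' Q' := by
  obtain ⟨s, hs, ν, hrun, hν⟩ := h
  exact ⟨s, hs.trans hb, ν, hrun, hQ ν (fun _ ha => hrun.frame ha) hν⟩

theorem skip (h : Q μ) : RamProg.skip.HaltsWithin G μ (b + 1) Q :=
  ⟨1, Nat.le_add_left _ _, μ, .skip μ, h⟩

theorem assign (hj : j.Safe G μ) (he : e.Safe G μ)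
    (h : Q (μ.write a (j.val G μ) (e.val G μ))) :
    (RamProg.assign a j e).HaltsWithin G μ (b + 1) Q :=
  ⟨1, Nat.le_add_left _ _, _, .assign hj he, h⟩

theorem seq {b' : ℕ} {P : RamMem → Prop} (h : p.HaltsWithin G μ b P)
    (h' : ∀ ν, (∀ a ∉ p.writes, ν a = μ a) → P ν → q.HaltsWithin G ν b' Q) :
    (RamProg.seq p q).HaltsWithin G μ (b + b' + 1) Q := by
  obtain ⟨s, hs, ν, hrun, hν⟩ := h
  obtain ⟨s', hs', ν', hrun', hν'⟩ := h' ν (fun _ ha => hrun.frame ha) hν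
  exact ⟨_, by omega, ν', .seq hrun hrun', hν'⟩

theorem assign_seq (hj : j.Safe G μ) (he : e.Safe G μ)
    (h : q.HaltsWithin G (μ.write a (j.val G μ) (e.val G μ)) b Q) :
    (RamProg.seq (.assign a j e) q).HaltsWithin G μ (b + 2) Q := by
  obtain ⟨s, hs, ν, hrun, hν⟩ := h
  exact ⟨_, by omega, ν, .seq (.assign hj he) hrun, hν⟩

theorem ite (hs : e.Safe G μ) (hp : e.val G μ ≠ 0 → p.HaltsWithin G μ b Q)
    (hq : e.val G μ = 0 → q.HaltsWithin G μ b Q) :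
    (RamProg.ite e p q).HaltsWithin G μ (b + 1) Q := by
  by_cases he : e.val G μ = 0
  · obtain ⟨s, hs', ν, hrun, hν⟩ := hq he
    exact ⟨_, by omega, ν, .ite_false hs he hrun, hν⟩
  · obtain ⟨s, hs', ν, hrun, hν⟩ := hp he
    exact ⟨_, by omega, ν, .ite_true hs he hrun, hν⟩

theorem loop (I : ℕ → RamMem → Prop) {k : ℕ} (hs : ∀ k μ, I k μ → e.Safe G μ)
    (hI : ∀ k μ, I k μ → e.val G μ ≠ 0 → p.HaltsWithin G μ b fun ν => ∃ k' < k, I k' ν)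
    (h : I k μ) (hQ : ∀ k ν, I k ν → e.val G ν = 0 → Q ν) :
    (RamProg.loop e p).HaltsWithin G μ (k * (b + 1) + 1) Q := by
  induction k using Nat.strong_induction_on generalizing μ with
  | _ k ih =>
    by_cases he : e.val G μ = 0
    · exact ⟨1, Nat.le_add_left _ _, μ, .loop_false (hs k μ h) he, hQ k μ h he⟩
    · obtain ⟨s, hsb, ν, hrun, k', hk', hν⟩ := hI k μ h he
      obtain ⟨s', hsb', ν', hrun', hν'⟩ := ih k' hk' hν
      have := Nat.mul_le_mul_right (b + 1) hk'
      rw [Nat.succ_mul] at this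
      exact ⟨_, by omega, ν', .loop_true (hs k μ h) he hrun hrun', hν'⟩

end HaltsWithin

end RamProg

/-- The variable with the number `a`, which is entry `0` of array `a`. -/
abbrev RamExpr.var (a : ℕ) : RamExpr := .get a (.lit 0)

/-- The assignment of the value of `e` to the variable with the number `a`. -/
abbrev RamProg.setVar (a : ℕ) (e : RamExpr) : RamProg := .assign a (.lit 0) e

/-- The program `for v < e do p`. -/
def RamProg.forLoop (v : ℕ) (e : RamExpr) (p : RamProg) : RamProg :=
  .seq (.setVar v (.lit 0)) (.loop (.sub e (.var v)) (.seq p (.setVar v (.add (.var v) (.lit 1)))))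

theorem RamProg.HaltsWithin.forLoop (I : ℕ → RamMem → Prop) {v : ℕ} {e : RamExpr} {p : RamProg}
    {μ : RamMem} {K b : ℕ} {Q : RamMem → Prop} (hv : v ∉ p.writes)
    (he : ∀ ν, (∀ a ∉ v :: p.writes, ν a = μ a) → e.Safe G ν ∧ e.val G ν = K)
    (h : I 0 (μ.write v 0 0))
    (hI : ∀ k < K, ∀ ν, (∀ a ∉ v :: p.writes, ν a = μ a) → ν v 0 = k → I k ν →
      p.HaltsWithin G ν b fun ν' => I (k + 1) (ν'.write v 0 (k + 1)))
    (hQ : ∀ ν, I K ν → Q ν) :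
    (RamProg.forLoop v e p).HaltsWithin G μ (K * (b + 3) + 3) Q := by
  refine assign_seq trivial trivial (loop
    (fun j ν => ∃ k ≤ K, j = K - k ∧ (∀ a ∉ v :: p.writes, ν a = μ a) ∧ ν v 0 = k ∧ I k ν)
    ?_ ?_ ⟨0, K.zero_le, rfl,
      fun a ha => RamMem.write_of_ne _ _ _ (List.ne_of_not_mem_cons ha),
      by simp [RamExpr.val], h⟩ ?_)
  · rintro _ ν ⟨k, -, -, hf, -⟩
    exact ⟨(he ν hf).1, trivial⟩
  · rintro _ ν ⟨k, -, rfl, hf, hνv, hν⟩ hne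
    simp only [RamExpr.val, (he ν hf).2, hνv] at hne
    refine (hI k (by omega) ν hf hνv hν).seq fun ν' hf' hν' =>
      assign (b := 0) trivial ⟨trivial, trivial⟩
      ⟨K - (k + 1), by omega, k + 1, by omega, rfl, fun a ha => ?_, ?_, ?_⟩
    · rw [RamMem.write_of_ne _ _ _ (List.ne_of_not_mem_cons ha),
        hf' a (List.not_mem_of_not_mem_cons ha), hf a ha]
    · simp [RamExpr.val, hf' v hv, hνv]
    · simpa [RamExpr.val, hf' v hv, hνv] using hν'
  · rintro _ ν ⟨k, hk, rfl, hf, hνv, hν⟩ h0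
    simp only [RamExpr.val, (he ν hf).2, hνv] at h0
    obtain rfl : k = K := by omega
    exact hQ ν hν

end

/-! ### Testing the rank constraints -/

/-- The number that is left of `t` after one binary digit, most significant digit first, has been
read off for every `r < s` with `g r ≠ 0`, where `E` is the power of two that bounds `t`. -/
def remainingDigits (E : ℕ) (g : ℕ → ℕ) (t : ℕ) : ℕ → ℕ
  | 0 => t
  | s + 1 =>
    if g s = 0 then remainingDigits E g t s
    else if E ≤ 2 * remainingDigits E g t s then 2 * remainingDigits E g t s - E
    else 2 * remainingDigits E g t s

/-- The digit of `t` that belongs to the member `s` of the support of `g` is one. Thus every number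
`t` encodes a subset of the support. -/
def DigitIsOne (E : ℕ) (g : ℕ → ℕ) (t s : ℕ) : Prop := g s ≠ 0 ∧ E ≤ 2 * remainingDigits E g t s

instance (E : ℕ) (g : ℕ → ℕ) (t s : ℕ) : Decidable (DigitIsOne E g t s) :=
  inferInstanceAs (Decidable (_ ∧ _))

theorem remainingDigits_succ' (E : ℕ) (g : ℕ → ℕ) (t s : ℕ) :
    remainingDigits E g t (s + 1) =
      remainingDigits E (fun s => g (s + 1)) (remainingDigits E g t 1) s := by
  induction s with
  | zero => rfl
  | succ s ih => rw [remainingDigits, ih]; rfl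

theorem digitIsOne_succ (E : ℕ) (g : ℕ → ℕ) (t s : ℕ) :
    DigitIsOne E g t (s + 1) ↔ DigitIsOne E (fun s => g (s + 1)) (remainingDigits E g t 1) s := by
  rw [DigitIsOne, DigitIsOne, remainingDigits_succ']

/-- Every subset `U` of the support is encoded. The divisibility keeps the digits that have not
been used yet free for the induction. -/
theorem exists_digitIsOne_iff {d m k : ℕ} {g : ℕ → ℕ} (U : ℕ → Prop)
    (hd : k + ∑ s ∈ Finset.range m, g s ≤ d) :
    ∃ t < 2 ^ d, 2 ^ k ∣ t ∧ ∀ s < m, DigitIsOne (2 ^ d) g t s ↔ g s ≠ 0 ∧ U s := by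
  induction m generalizing k g U with
  | zero => exact ⟨0, by positivity, dvd_zero _, by simp⟩
  | succ m ih =>
    rw [Finset.sum_range_succ'] at hd
    by_cases h0 : g 0 = 0
    · obtain ⟨t, ht, hdvd, hsel⟩ := ih (g := fun s => g (s + 1)) (fun s => U (s + 1))
        (show k + _ ≤ d by omega)
      refine ⟨t, ht, hdvd, fun s hs => ?_⟩
      obtain _ | s := s
      · simp [DigitIsOne, h0]
      · simpa [digitIsOne_succ, remainingDigits, h0] using hsel s (by omega)
    obtain ⟨d, rfl⟩ : ∃ e, d = e + 1 := ⟨d - 1, by omega⟩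
    obtain ⟨_, ht, ⟨u, rfl⟩, hsel⟩ := ih (g := fun s => g (s + 1)) (fun s => U (s + 1))
      (show k + 1 + _ ≤ d + 1 by omega)
    have hu : 2 ^ (k + 1) * u = 2 * (2 ^ k * u) := by ring
    have hE : 2 ^ (d + 1) = 2 * 2 ^ d := pow_succ' 2 d
    suffices h : ∃ t < 2 ^ (d + 1), 2 ^ k ∣ t ∧ remainingDigits (2 ^ (d + 1)) g t 1 =
        2 ^ (k + 1) * u ∧ (2 ^ d ≤ t ↔ U 0) by
      obtain ⟨t, ht, hdvd, hrest, htU⟩ := h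
      refine ⟨t, ht, hdvd, fun s hs => ?_⟩
      obtain _ | s := s
      · simp only [DigitIsOne, remainingDigits, ← htU, hE, Nat.mul_le_mul_left_iff two_pos]
      · rw [digitIsOne_succ, hrest, hsel s (by omega)]
    by_cases hU : U 0
    · refine ⟨2 ^ k * u + 2 ^ d, by omega,
        (dvd_mul_right _ _).add (pow_dvd_pow 2 (by omega)), ?_, iff_of_true (by omega) hU⟩
      rw [remainingDigits, remainingDigits, if_neg h0, if_pos (by omega)]
      omega
    · refine ⟨2 ^ k * u, by omega, dvd_mul_right _ _, ?_, iff_of_false (by omega) hU⟩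
      rw [remainingDigits, remainingDigits, if_neg h0, if_neg (by omega), hu]

section

variable {n m : ℕ} {G : PolymatroidGame (Fin n) (Fin m)}

theorem rankOracle_congr {i : ℕ} {A A' : ℕ → ℕ} (h : ∀ r < m, A r ≠ 0 ↔ A' r ≠ 0) :
    rankOracle G i A = rankOracle G i A' := by
  unfold rankOracle
  split_ifs with hi
  · congr 1
    ext r
    simpa only [Finset.mem_filter, Finset.mem_univ, true_and] using h r r.2
  · rfl

/-- Subsets of the support suffice for testing independence. -/
theorem forall_sum_digitIsOne_le_rankOracle_iff (i : Fin n) (g : ℕ → ℕ) {d : ℕ}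
    (hd : ∑ s ∈ Finset.range m, g s ≤ d) :
    (∀ t < 2 ^ d, (∑ s ∈ Finset.range m, if DigitIsOne (2 ^ d) g t s then g s else 0) ≤
      rankOracle G i fun s => if DigitIsOne (2 ^ d) g t s then 1 else 0) ↔
    (G.f i).Indep fun r => g r := by
  have hval (t : ℕ) : ((∑ s ∈ Finset.range m, if DigitIsOne (2 ^ d) g t s then g s else 0) ≤
      rankOracle G i fun s => if DigitIsOne (2 ^ d) g t s then 1 else 0) ↔
      ∑ r ∈ {r : Fin m | DigitIsOne (2 ^ d) g t r}, g r ≤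
        (G.f i).rank {r : Fin m | DigitIsOne (2 ^ d) g t r} := by
    rw [Finset.sum_range (fun s => if DigitIsOne (2 ^ d) g t s then g s else 0), Finset.sum_filter]
    simp [rankOracle]
  simp only [hval]
  refine ⟨fun h U => ?_, fun h t _ => h _⟩
  obtain ⟨t, ht, -, hsel⟩ := exists_digitIsOne_iff (m := m) (k := 0) (g := g)
    (fun s => ∃ h : s < m, (⟨s, h⟩ : Fin m) ∈ U) ((Nat.zero_add _).trans_le hd)
  have hsupp : ({r : Fin m | DigitIsOne (2 ^ d) g t r} : Finset (Fin m)) =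
      U.filter fun r : Fin m => g r ≠ 0 := by
    ext r
    simp [hsel r r.2, and_comm]
  have := h t ht
  rw [hsupp, Finset.sum_filter_ne_zero] at this
  exact this.trans ((G.f i).monotone _ _ (Finset.filter_subset _ _))

end

namespace RamProg

open RamExpr PolymatroidGame

-- The arrays of the program. The first four hold the input `n`, `m`, the demands, the strategies
-- row by row, and the loads of the resources. The fifth is the argument of rank queries, and the
-- others are variables.
abbrev sizes : ℕ := 0
abbrev demands : ℕ := 1
abbrev strategies : ℕ := 2
abbrev loads : ℕ := 3
abbrev chosen : ℕ := 4
abbrev player : ℕ := 5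
abbrev unitCount : ℕ := 6
abbrev mover : ℕ := 7
abbrev marked : ℕ := 8
abbrev candidate : ℕ := 9
abbrev best : ℕ := 10
abbrev feasible : ℕ := 11
abbrev subset : ℕ := 12
abbrev full : ℕ := 13
abbrev rest : ℕ := 14
abbrev subsetSum : ℕ := 15
abbrev resource : ℕ := 16
abbrev exponent : ℕ := 17

/-- The address of the number of units of the player `mover` on resource `r`. -/
def address (r : RamExpr) : RamExpr := .add (.mul (var mover) (.get sizes (.lit 1))) r

/-- The number of units of the player `mover` on resource `r`. -/
def entry (r : RamExpr) : RamExpr := .get strategies (address r)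

/-- Reads off the digit of `rest` for the variable `resource`, and adds the resource to the subset
`chosen` if it is one. -/
def decodeStep : RamProg :=
  .seq (.assign chosen (var resource) (.lit 0)) <|
  .ite (entry (var resource))
    (.seq (.setVar rest (.add (var rest) (var rest))) <|
      .ite (.sub (.add (var rest) (.lit 1)) (var full))
        (.seq (.assign chosen (var resource) (.lit 1)) <|
          .seq (.setVar subsetSum (.add (var subsetSum) (entry (var resource)))) <|
          .setVar rest (.sub (var rest) (var full)))
        .skip)
    .skip

/-- Tests the rank constraint of the player `mover` for the subset that `subset` encodes. -/
def testSubset : RamProg :=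
  .seq (.setVar rest (var subset)) <|
  .seq (.setVar subsetSum (.lit 0)) <|
  .seq (.forLoop resource (.get sizes (.lit 1)) decodeStep) <|
  .ite (.sub (var subsetSum) (.rank (var mover) chosen)) (.setVar feasible (.lit 0)) .skip

/-- Sets `feasible` to a nonzero value if and only if the strategy of the player `mover` satisfies
the rank constraints. -/
def checkIndep : RamProg :=
  .seq (.setVar full (.lit 1)) <|
  .seq (.forLoop exponent (.get demands (var mover)) (.setVar full (.add (var full) (var full)))) <|
  .seq (.setVar feasible (.lit 1)) <|
  .forLoop subset (var full) testSubset

/-- A bound for the number of steps of `checkIndep` if the player `mover` has demand `d`. It is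
defined in all commutative semirings so that it can be read as a polynomial in `m`, too. -/
def checkBound {A : Type*} [CommSemiring A] (m : A) (d : ℕ) : A :=
  d * 4 + 2 ^ d * (m * 14 + 13) + 11

section

variable {n m : ℕ} {G : PolymatroidGame (Fin n) (Fin m)} {μ : RamMem} {i : Fin n} {E t s : ℕ}
  {g : ℕ → ℕ}

/-- The memory while the rank constraints of player `i` with the strategy `g` are tested by means
of numbers below `E`. -/
structure ReadsRow (m : ℕ) (μ : RamMem) (i E : ℕ) (g : ℕ → ℕ) : Prop where
  resources : μ sizes 1 = m
  mover : μ mover 0 = i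
  full : μ full 0 = E
  row : ∀ r, μ strategies (i * m + r) = g r

theorem ReadsRow.congr {ν : RamMem} {i : ℕ} (h : ReadsRow m μ i E g)
    (hν : ∀ a ∈ [sizes, RamProg.mover, RamProg.full, strategies], ν a = μ a) :
    ReadsRow m ν i E g where
  resources := by rw [hν _ (by decide), h.resources]
  mover := by rw [hν _ (by decide), h.mover]
  full := by rw [hν _ (by decide), h.full]
  row r := by rw [hν _ (by decide), h.row]

theorem ReadsRow.val_entry {i : ℕ} (h : ReadsRow m μ i E g) (r : RamExpr) :
    (entry r).val G μ = g (r.val G μ) := by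
  simp [entry, address, RamExpr.val, h.mover, h.resources, h.row]

theorem entry_safe {r : RamExpr} (h : r.Safe G μ) : (entry r).Safe G μ := ⟨⟨trivial, trivial⟩, h⟩

/-- The situation after the digits for the resources below `s` have been read off. -/
structure Decoded (μ : RamMem) (E : ℕ) (g : ℕ → ℕ) (t s : ℕ) : Prop where
  rest : μ rest 0 = remainingDigits E g t s
  sum : μ subsetSum 0 = ∑ r ∈ Finset.range s, if DigitIsOne E g t r then g r else 0
  chosen : ∀ r < s, μ chosen r = if DigitIsOne E g t r then 1 else 0

theorem Decoded.of_succ (h : Decoded μ E g t s) {ν : RamMem}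
    (hrest : ν RamProg.rest 0 = remainingDigits E g t (s + 1))
    (hsum : ν subsetSum 0 = μ subsetSum 0 + if DigitIsOne E g t s then g s else 0)
    (hchosen : ν RamProg.chosen =
      Function.update (μ RamProg.chosen) s (if DigitIsOne E g t s then 1 else 0)) :
    Decoded ν E g t (s + 1) where
  rest := hrest
  sum := by rw [hsum, h.sum, Finset.sum_range_succ]
  chosen r hr := by
    rw [hchosen]
    obtain rfl | hne := eq_or_ne r s
    · rw [Function.update_self]
    · rw [Function.update_of_ne hne, h.chosen r (by omega)]

theorem decodeStep_halts {i : ℕ} (h : ReadsRow m μ i E g) (hd : Decoded μ E g t s)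
    (hs : μ resource 0 = s) :
    decodeStep.HaltsWithin G μ 11 fun ν => Decoded ν E g t (s + 1) := by
  have hrow : ReadsRow m (μ.write chosen s 0) i E g := h.congr (by simp +decide)
  have hentry : (entry (var resource)).val G (μ.write chosen s 0) = g s := by
    simp +decide [hrow.val_entry, RamExpr.val, hs]
  have hrest := hd.rest
  refine .assign_seq trivial trivial (.ite (entry_safe trivial) (fun hne => ?_) fun h0 => ?_)
  · simp only [RamExpr.val, hs] at hne ⊢
    rw [hentry] at hne
    refine .assign_seq trivial ⟨trivial, trivial⟩ (.ite ⟨⟨trivial, trivial⟩, trivial⟩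
      (fun hle => ?_) fun hlt => ?_)
    · have hone : DigitIsOne E g t s := ⟨hne, by
        simp +decide [RamExpr.val, hrest, h.full] at hle; omega⟩
      refine .assign_seq trivial trivial ?_
      refine .assign_seq trivial ⟨trivial, entry_safe trivial⟩
        (.assign trivial ⟨trivial, trivial⟩ (hd.of_succ ?_ ?_ ?_))
      · simp +decide [RamExpr.val, remainingDigits, hne, hone.2, hrest, h.full, ← two_mul]
      · simp +decide [RamExpr.val, entry, address, hone, hs, h.resources, h.mover, h.row]
      · simp +decide [RamExpr.val, hone, hs]
    · have hle : ¬ E ≤ 2 * remainingDigits E g t s := by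
        simp +decide [RamExpr.val, hrest, h.full] at hlt; omega
      refine .skip <| hd.of_succ ?_ ?_ ?_ <;>
        simp +decide [RamExpr.val, DigitIsOne, remainingDigits, hne, hle, hrest, ← two_mul]
  · simp only [RamExpr.val, hs] at h0 ⊢
    rw [hentry] at h0
    refine .skip <| hd.of_succ ?_ ?_ ?_ <;> simp +decide [DigitIsOne, remainingDigits, h0, hrest]

variable (G) in
/-- The rank constraint of player `i` for the subset that `t` encodes. -/
def RankConstraint (i E : ℕ) (g : ℕ → ℕ) (t : ℕ) : Prop :=
  (∑ r ∈ Finset.range m, if DigitIsOne E g t r then g r else 0) ≤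
    rankOracle G i fun r => if DigitIsOne E g t r then 1 else 0

theorem decodeLoop_halts {i : ℕ} (h : ReadsRow m μ i E g) (hrest : μ rest 0 = t)
    (hsum : μ subsetSum 0 = 0) :
    (forLoop resource (.get sizes (.lit 1)) decodeStep).HaltsWithin G μ (m * 14 + 3) fun ν =>
      Decoded ν E g t m := by
  refine .forLoop (fun s ν => Decoded ν E g t s) (by decide) (fun ν hν => ⟨trivial, ?_⟩) ?_
    (fun s _ ν hν hs hd => ?_) (fun ν hν => hν)
  · simp +decide [RamExpr.val, hν, h.resources]
  · constructor <;> simp +decide [remainingDigits, hrest, hsum]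
  · refine (decodeStep_halts (h.congr ?_) hd hs).mono le_rfl fun ν' _ hd' => ?_
    · simp +decide [hν]
    · exact ⟨by simp +decide [hd'.rest], by simp +decide [hd'.sum],
        fun r hr => by rw [RamMem.write_of_ne _ _ _ (by decide), hd'.chosen r hr]⟩

theorem testSubset_halts {i : ℕ} (h : ReadsRow m μ i E g) (ht : μ subset 0 = t) :
    testSubset.HaltsWithin G μ (m * 14 + 10) fun ν =>
      ν feasible 0 ≠ 0 ↔ μ feasible 0 ≠ 0 ∧ RankConstraint G i E g t := by
  refine .assign_seq trivial trivial (.assign_seq trivial trivial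
    (.seq (b := m * 14 + 3) (b' := 2) (decodeLoop_halts (i := i) (t := t) (h.congr ?_) ?_ ?_)
    fun ν hf hd => ?_))
  · simp +decide
  · simp +decide [RamExpr.val, ht]
  · simp [RamExpr.val]
  have horacle : rankOracle G i (ν chosen) =
      rankOracle G i fun r => if DigitIsOne E g t r then 1 else 0 :=
    rankOracle_congr fun r hr => by rw [hd.chosen r hr]
  have hval : (RamExpr.sub (var subsetSum) (.rank (var mover) chosen)).val G ν = 0 ↔
      RankConstraint G i E g t := by
    simp +decide [RamExpr.val, hd.sum, hf, h.mover, horacle, Nat.sub_eq_zero_iff_le, RankConstraint]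
  refine .ite ⟨trivial, trivial⟩ (fun hne => .assign trivial trivial ?_) fun h0 => .skip ?_
  · simp [RamExpr.val, mt hval.2 hne]
  · simp +decide [hval.1 h0, hf]

theorem doublingLoop_halts {d : ℕ} (hd : μ demands (μ mover 0) = d) (hfull : μ full 0 = 1) :
    (forLoop exponent (.get demands (var mover))
      (.setVar full (.add (var full) (var full)))).HaltsWithin G μ (d * 4 + 3) fun ν =>
      ν full 0 = 2 ^ d := by
  refine .forLoop (fun k ν => ν full 0 = 2 ^ k) (by decide) (fun ν hν => ⟨trivial, ?_⟩) ?_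
    (fun k _ ν _ _ h => .assign trivial ⟨trivial, trivial⟩ ?_) (fun ν hν => hν)
  · simp +decide [RamExpr.val, hν, hd]
  · simp +decide [hfull]
  · simp +decide [RamExpr.val, h, pow_succ, mul_two]

theorem checkIndep_halts {i : Fin n} {d : ℕ} (hm : μ sizes 1 = m) (hi : μ mover 0 = i)
    (hd : μ demands i = d) (hg : ∀ r, μ strategies (i * m + r) = g r)
    (hgd : ∑ r ∈ Finset.range m, g r ≤ d) :
    checkIndep.HaltsWithin G μ (checkBound m d) fun ν =>
      ν feasible 0 ≠ 0 ↔ (G.f i).Indep fun r => g r := by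
  refine .mono (b := d * 4 + 3 + (2 ^ d * (m * 14 + 13) + 5) + 3) ?_
    (by simp only [checkBound, Nat.cast_id]; omega) fun _ _ hν => hν
  refine .assign_seq trivial trivial (.seq (doublingLoop_halts (d := d) ?_ ?_) fun ν hf hfull => ?_)
  · simp +decide [hi, hd]
  · simp [RamExpr.val]
  have hrow : ReadsRow m ν i (2 ^ d) g :=
    ⟨by simp +decide [hf, hm], by simp +decide [hf, hi], hfull, by simp +decide [hf, hg]⟩
  refine .assign_seq trivial trivial (.forLoop
    (fun k ξ => ξ feasible 0 ≠ 0 ↔ ∀ t < k, RankConstraint G i (2 ^ d) g t) (by decide)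
    (fun ξ hξ => ⟨trivial, ?_⟩) ?_ (fun t _ ξ hξ ht hok => ?_) fun ξ hξ => ?_)
  · simp +decide [RamExpr.val, hξ, hfull]
  · simp +decide [RamExpr.val]
  · refine (testSubset_halts (hrow.congr ?_) ht).mono le_rfl fun ξ' _ hok' => ?_
    · simp +decide [hξ]
    · rw [RamMem.write_of_ne _ _ _ (by decide), hok', hok, Nat.forall_lt_succ_right]
  · exact hξ.trans (forall_sum_digitIsOne_le_rankOracle_iff i g hgd)

end

/-- Adds a unit of the player `mover` to resource `r`. -/
def place (r : RamExpr) : RamProg :=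
  .seq (.assign strategies (address r) (.add (entry r) (.lit 1)))
    (.assign loads r (.add (.get loads r) (.lit 1)))

/-- Takes a unit of the player `mover` away from resource `r`. -/
def remove (r : RamExpr) : RamProg :=
  .seq (.assign strategies (address r) (.sub (entry r) (.lit 1)))
    (.assign loads r (.sub (.get loads r) (.lit 1)))

/-- The marginal cost of the player `mover` for another unit on resource `r`. -/
def increase (r : RamExpr) : RamExpr :=
  .sub (.mul (.cost (var mover) r (.add (.get loads r) (.lit 1))) (.add (entry r) (.lit 1)))
    (.mul (.cost (var mover) r (.get loads r)) (entry r))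

section

variable {n m : ℕ} {G : PolymatroidGame (Fin n) (Fin m)} {μ ν : RamMem} {x : Fin n → Fin m → ℕ}
  {i : Fin n} {q r : Fin m} {b d : ℕ}

variable (G) in
/-- The memory holds the input, and the profile `x` with its loads. -/
structure Represents (μ : RamMem) (x : Fin n → Fin m → ℕ) : Prop where
  players : μ sizes 0 = n
  resources : μ sizes 1 = m
  demand : ∀ i : Fin n, μ demands i = G.demand i
  profile : ∀ (i : Fin n) (r : Fin m), μ strategies (i * m + r) = x i r
  load_eq : ∀ r : Fin m, μ loads r = load x r

theorem Represents.congr (h : Represents G μ x)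
    (hν : ∀ a ∈ [sizes, demands, strategies, loads], ν a = μ a) : Represents G ν x where
  players := by rw [hν _ (by decide), h.players]
  resources := by rw [hν _ (by decide), h.resources]
  demand i := by rw [hν _ (by decide), h.demand]
  profile i r := by rw [hν _ (by decide), h.profile]
  load_eq r := by rw [hν _ (by decide), h.load_eq]

theorem mul_add_inj {i j : ℕ} {r t : Fin m} : i * m + r = j * m + t ↔ i = j ∧ r = t := by
  refine ⟨fun h => ?_, by rintro ⟨rfl, rfl⟩; rfl⟩
  have hdiv := congrArg (· / m) h
  have hmod := congrArg (· % m) h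
  simp only [Nat.mul_add_mod', Nat.mod_eq_of_lt r.2, Nat.mod_eq_of_lt t.2] at hmod
  simp only [Nat.mul_comm _ m, Nat.mul_add_div r.pos, Nat.div_eq_of_lt r.2,
    Nat.div_eq_of_lt t.2] at hdiv
  exact ⟨hdiv, Fin.ext hmod⟩

theorem Represents.update (h : Represents G μ x) {y : Fin m → ℕ} (hy : ∀ t, t ≠ r → y t = x i t)
    (hν : ∀ a ∈ [sizes, demands], ν a = μ a)
    (hstrategies : ν strategies = Function.update (μ strategies) (i * m + r) (y r))
    (hloads : ν loads = Function.update (μ loads) r (others x i r + y r)) :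
    Represents G ν (Function.update x i y) where
  players := by rw [hν _ (by decide), h.players]
  resources := by rw [hν _ (by decide), h.resources]
  demand j := by rw [hν _ (by decide), h.demand]
  profile j t := by
    simp only [hstrategies, Function.update_apply, mul_add_inj, h.profile, Fin.val_inj]
    split_ifs with hjt hj hj
    · rw [hjt.2]
    · exact absurd hjt.1 hj
    · rw [hj, hy t fun ht => hjt ⟨hj, ht⟩]
    · rfl
  load_eq t := by
    rw [hloads, load_update, Pi.add_apply]
    obtain rfl | ht := eq_or_ne t r
    · rw [Function.update_self]
    · rw [Function.update_of_ne (Fin.val_injective.ne ht), h.load_eq, load_eq_others_add x i,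
        Pi.add_apply, hy t ht]

theorem Represents.val_entry (h : Represents G μ x) (hi : μ mover 0 = i) (hr : μ b 0 = r) :
    (entry (var b)).val G μ = x i r := by
  simp [entry, address, RamExpr.val, hi, hr, h.resources, h.profile]

theorem place_halts (h : Represents G μ x) (hi : μ mover 0 = i) (hr : μ b 0 = r)
    (hb : b ≠ strategies) :
    (place (var b)).HaltsWithin G μ 3 fun ν =>
      Represents G ν (Function.update x i (addUnit (x i) r)) := by
  refine .assign_seq ⟨⟨trivial, trivial⟩, trivial⟩ ⟨entry_safe trivial, trivial⟩
    (.assign trivial ⟨trivial, trivial⟩ (h.update (r := r) (fun t ht => addUnit_of_ne _ ht)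
      (by simp +decide) ?_ ?_))
  · simp +decide [RamExpr.val, h.val_entry hi hr, address, hi, hr, h.resources]
  · simp +decide [RamExpr.val, hr, hb, h.load_eq, load_eq_others_add x i, add_assoc]

theorem remove_halts (h : Represents G μ x) (hi : μ mover 0 = i) (hr : μ b 0 = r)
    (hb : b ≠ strategies) {z : Fin m → ℕ} (hz : x i = addUnit z r) :
    (remove (var b)).HaltsWithin G μ 3 fun ν => Represents G ν (Function.update x i z) := by
  refine .assign_seq ⟨⟨trivial, trivial⟩, trivial⟩ ⟨entry_safe trivial, trivial⟩
    (.assign trivial ⟨trivial, trivial⟩ (h.update (r := r)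
      (fun t ht => by rw [hz, addUnit_of_ne _ ht]) (by simp +decide) ?_ ?_))
  · simp +decide [RamExpr.val, h.val_entry hi hr, address, hi, hr, h.resources, hz]
  · simp +decide [RamExpr.val, hr, hb, h.load_eq, load_eq_others_add x i, hz]

theorem Represents.increase_safe (h : Represents G μ x) (hr : μ b 0 = r)
    (hload : load x r < ∑ j, G.demand j) : (increase (var b)).Safe G μ := by
  have hget : (RamExpr.get loads (var b)).val G μ = load x r := by simp [RamExpr.val, hr, h.load_eq]
  refine ⟨⟨⟨⟨trivial, trivial, trivial, trivial⟩, ?_⟩, entry_safe trivial, trivial⟩,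
    ⟨⟨trivial, trivial, trivial⟩, hget.trans_le hload.le⟩, entry_safe trivial⟩
  rw [RamExpr.val, hget]
  exact hload

theorem Represents.val_increase (h : Represents G μ x) (hi : μ mover 0 = i) (hr : μ b 0 = r) :
    ((increase (var b)).val G μ : ℤ) = G.marginalCost i (others x i) (x i) r := by
  have hcost (L : ℕ) : costOracle G i r L = G.c i r L := by simp [costOracle]
  have hle : G.c i r (load x r) * x i r ≤ G.c i r (load x r + 1) * (x i r + 1) :=
    Nat.mul_le_mul (G.cost_mono i r (Nat.le_succ _)) (Nat.le_succ _)
  have hval : (increase (var b)).val G μ =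
      G.c i r (load x r + 1) * (x i r + 1) - G.c i r (load x r) * x i r := by
    simp only [increase, RamExpr.val, h.val_entry hi hr, hi, hr, h.load_eq, hcost]
  rw [hval, Nat.cast_sub hle, marginalCost, inc, ← Pi.add_apply, ← load_eq_others_add]
  push_cast
  rfl

theorem load_lt_sum_demand (hx : ∀ j, ∑ r, x j r ≤ G.demand j) (hi : ∑ r, x i r < G.demand i)
    (r : Fin m) : load x r < ∑ j, G.demand j :=
  have hle (j : Fin n) : x j r ≤ ∑ r, x j r :=
    Finset.single_le_sum (fun _ _ => Nat.zero_le _) (Finset.mem_univ r)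
  Finset.sum_lt_sum (fun j _ => (hle j).trans (hx j)) ⟨i, Finset.mem_univ i, (hle i).trans_lt hi⟩

end

/-- Determines whether the player `mover` can add a unit on the resource `candidate`. -/
def tryUnit : RamProg :=
  .seq (place (var candidate)) (.seq checkIndep (remove (var candidate)))

/-- Replaces `best` by `candidate` if `candidate` is feasible and cheaper, or if no feasible
resource has been found before. -/
def updateBest : RamProg :=
  .ite (var feasible)
    (.ite (.sub (.get sizes (.lit 1)) (var best))
      (.ite (.sub (increase (var best)) (increase (var candidate)))
        (.setVar best (var candidate)) .skip)
      (.setVar best (var candidate)))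
    .skip

/-- Sets `best` to a cheapest resource on which the player `mover` can add a unit. -/
def findBest : RamProg :=
  .seq (.setVar best (.get sizes (.lit 1))) <|
  .forLoop candidate (.get sizes (.lit 1)) (.seq tryUnit updateBest)

/-- A bound for the number of steps of `findBest`, analogous to `checkBound`. -/
def findBound {A : Type*} [CommSemiring A] (m : A) (d : ℕ) : A :=
  m * (checkBound m d + 16) + 5

section

variable {n m : ℕ} {G : PolymatroidGame (Fin n) (Fin m)} {μ : RamMem} {x : Fin n → Fin m → ℕ}
  {i : Fin n} {q : Fin m} {d k b : ℕ} {F : Fin m → Prop} {w : Fin m → ℤ}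

/-- Among the resources below `k`, `b` is one of least weight `w` with property `F`, and it is `m`
if there are none. -/
def BestBelow (F : Fin m → Prop) (w : Fin m → ℤ) (k b : ℕ) : Prop :=
  (b = m ∧ ∀ q : Fin m, q < k → ¬ F q) ∨
    ∃ t : Fin m, b = t ∧ F t ∧ ∀ q : Fin m, q < k → F q → w t ≤ w q

theorem bestBelow_zero : BestBelow F w 0 m := .inl ⟨rfl, fun _ hq => absurd hq (Nat.not_lt_zero _)⟩

theorem forall_lt_val_succ {p : Fin m → Prop} :
    (∀ t : Fin m, (t : ℕ) < q + 1 → p t) ↔ (∀ t : Fin m, (t : ℕ) < q → p t) ∧ p q := by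
  refine ⟨fun h => ⟨fun t ht => h t (by omega), h q (by omega)⟩, fun h t ht => ?_⟩
  obtain ht | ht := Nat.lt_succ_iff_lt_or_eq.1 ht
  · exact h.1 t ht
  · exact Fin.ext ht ▸ h.2

theorem BestBelow.succ (h : BestBelow F w q b) (hq : F q → ∃ t : Fin m, b = t ∧ w t ≤ w q) :
    BestBelow F w (q + 1) b := by
  simp only [BestBelow, forall_lt_val_succ] at h ⊢
  obtain ⟨rfl, hnone⟩ | ⟨t, rfl, hFt, hmin⟩ := h
  · refine .inl ⟨rfl, hnone, fun hF => ?_⟩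
    obtain ⟨t, ht, -⟩ := hq hF
    exact t.2.ne ht.symm
  · refine .inr ⟨t, rfl, hFt, hmin, fun hF => ?_⟩
    obtain ⟨t', ht', hle⟩ := hq hF
    rwa [Fin.ext ht']

theorem BestBelow.succ_self (h : BestBelow F w q b) (hq : F q)
    (hlt : ∀ t : Fin m, b = t → w q ≤ w t) : BestBelow F w (q + 1) q := by
  refine .inr ⟨q, rfl, hq, forall_lt_val_succ.2 ⟨fun s hs hFs => ?_, fun _ => le_rfl⟩⟩
  obtain ⟨-, hnone⟩ | ⟨t, rfl, -, hmin⟩ := h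
  · exact absurd hFs (hnone s hs)
  · exact (hlt t rfl).trans (hmin s hs hFs)

theorem BestBelow.exists_forall_le (h : BestBelow F w m b) (hex : ∃ q, F q) :
    ∃ t : Fin m, b = t ∧ F t ∧ ∀ q, F q → w t ≤ w q := by
  obtain ⟨-, hnone⟩ | ⟨t, ht, hFt, hmin⟩ := h
  · exact absurd hex.choose_spec (hnone _ hex.choose.2)
  · exact ⟨t, ht, hFt, fun q => hmin q q.2⟩

theorem tryUnit_halts (h : Represents G μ x) (hi : μ mover 0 = i) (hq : μ candidate 0 = q)
    (hd : ∑ r, x i r + 1 = d) (hdi : d ≤ G.demand i) :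
    tryUnit.HaltsWithin G μ (checkBound m (G.demand i) + 8) fun ν =>
      Represents G ν x ∧ (ν feasible 0 ≠ 0 ↔ addUnit (x i) q ∈ (G.f i).base d) := by
  have hsum : ∑ r, addUnit (x i) q r = d := by rw [univ_sum_addUnit, hd]
  refine .mono (b := 3 + (checkBound m (G.demand i) + 3 + 1) + 1) ?_ (by omega) fun _ _ hν => hν
  refine (place_halts h hi hq (by decide)).seq fun ν hfν hν => ?_
  have hrow (r : Fin m) : ν strategies (i * m + r) = addUnit (x i) q r := by
    rw [hν.profile, Function.update_self]
  have hcheck := checkIndep_halts (G := G) (g := fun r => ν strategies (i * m + r)) hν.resources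
    (by rw [hfν _ (by decide), hi]) (hν.demand i) (fun _ => rfl)
    (by simpa only [Finset.sum_range, hrow, hsum])
  refine hcheck.seq fun ξ hfξ hξ => ?_
  have hremove := remove_halts (hν.congr (ν := ξ) (by simp +decide [hfξ])) (i := i) (r := q)
    (b := candidate) (by rw [hfξ _ (by decide), hfν _ (by decide), hi])
    (by rw [hfξ _ (by decide), hfν _ (by decide), hq]) (by decide) (Function.update_self ..)
  refine hremove.mono le_rfl fun ρ hfρ hρ => ⟨?_, ?_⟩
  · rwa [Function.update_idem, Function.update_eq_self] at hρ
  · rw [hfρ _ (by decide), hξ]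
    simp only [hrow]
    exact ⟨fun hF => ⟨hF, hsum⟩, fun hF => hF.1⟩

theorem updateBest_halts (h : Represents G μ x) (hi : μ mover 0 = i) (hq : μ candidate 0 = q)
    (hload : ∀ r, load x r < ∑ j, G.demand j) (hF : μ feasible 0 ≠ 0 ↔ F q)
    (hb : BestBelow F (G.marginalCost i (others x i) (x i)) q (μ best 0)) :
    updateBest.HaltsWithin G μ 4 fun ν =>
      BestBelow F (G.marginalCost i (others x i) (x i)) (q + 1) (ν best 0) := by
  have hreplace (hFq : F q) (hle : ∀ t : Fin m, μ best 0 = t →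
      G.marginalCost i (others x i) (x i) q ≤ G.marginalCost i (others x i) (x i) t) :
      BestBelow F (G.marginalCost i (others x i) (x i)) (q + 1)
        (μ.write best 0 (μ candidate 0) best 0) := by
    rw [RamMem.write_self, Function.update_self, hq]
    exact hb.succ_self hFq hle
  refine .ite trivial (fun hf => ?_) fun hf => .skip (hb.succ fun hFq => absurd hf (hF.2 hFq))
  refine .ite ⟨trivial, trivial⟩ (fun hlt => ?_) fun hge => ?_
  · obtain ⟨t, ht⟩ : ∃ t : Fin m, μ best 0 = t :=
      ⟨⟨μ best 0, by simpa [RamExpr.val, h.resources, Nat.sub_eq_zero_iff_le] using hlt⟩, rfl⟩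
    have hcomp : (RamExpr.sub (increase (var best)) (increase (var candidate))).val G μ = 0 ↔
        G.marginalCost i (others x i) (x i) t ≤ G.marginalCost i (others x i) (x i) q := by
      rw [← h.val_increase hi ht, ← h.val_increase hi hq, Nat.cast_le, ← Nat.sub_eq_zero_iff_le]
      rfl
    refine .ite ⟨h.increase_safe ht (hload t), h.increase_safe hq (hload q)⟩
      (fun hgt => .assign trivial trivial (hreplace (hF.1 hf) fun t' ht' => ?_))
      fun hle => .skip (hb.succ fun _ => ⟨t, ht, hcomp.1 hle⟩)
    obtain rfl : t = t' := Fin.ext (ht.symm.trans ht')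
    exact (not_le.1 (mt hcomp.2 hgt)).le
  · refine .assign trivial trivial (hreplace (hF.1 hf) fun t ht => absurd hge ?_)
    simp [RamExpr.val, h.resources, ht, Nat.sub_eq_zero_iff_le]

theorem findBest_halts (h : Represents G μ x) (hi : μ mover 0 = i)
    (hload : ∀ r, load x r < ∑ j, G.demand j) (hd : ∑ r, x i r + 1 = d) (hdi : d ≤ G.demand i)
    (hex : ∃ q, addUnit (x i) q ∈ (G.f i).base d) :
    findBest.HaltsWithin G μ (findBound m (G.demand i)) fun ν => Represents G ν x ∧
      ∃ t : Fin m, ν best 0 = t ∧ G.IsCheapestUnit i d (others x i) (x i) t := by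
  refine .assign_seq trivial trivial (.forLoop
    (fun k ν => Represents G ν x ∧ BestBelow (fun q => addUnit (x i) q ∈ (G.f i).base d)
      (G.marginalCost i (others x i) (x i)) k (ν best 0)) (by decide)
    (fun ν hν => ⟨trivial, ?_⟩) ⟨h.congr (by simp +decide), ?_⟩
    (fun k hk ν hf hν ⟨hrep, hb⟩ => ?_) fun ν ⟨hrep, hb⟩ => ⟨hrep, hb.exists_forall_le hex⟩)
  · simp +decide [RamExpr.val, hν, h.resources]
  · simpa +decide [RamExpr.val, h.resources] using bestBelow_zero
  · have hmover : ν mover 0 = i := by simp +decide [hf, hi]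
    refine (tryUnit_halts hrep hmover (q := ⟨k, hk⟩) hν hd hdi).seq (b' := 4)
      fun ξ hfξ ⟨hξ, hF⟩ => ?_
    refine (updateBest_halts hξ (q := ⟨k, hk⟩) (by rw [hfξ _ (by decide), hmover])
      (by rw [hfξ _ (by decide), hν]) hload hF (by rwa [hfξ _ (by decide)])).mono le_rfl
      fun ρ hfρ hρ => ⟨hξ.congr ?_, ?_⟩
    · simp +decide [hfρ]
    · rwa [RamMem.write_of_ne _ _ _ (by decide)]

end

end RamProg

/-! ### The program for the algorithm -/

namespace RamProg

open RamExpr PolymatroidGame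

/-- Continues with the next player. -/
def nextMover : RamProg := .setVar mover (.add (var mover) (.lit 1))

/-- Puts a unit of the player `mover` that has been removed from the resource `marked` on the
resource `best` if it is cheaper there, and back on `marked` if not. -/
def reinsert : RamProg :=
  .ite (.sub (increase (var marked)) (increase (var best)))
    (.seq (place (var best)) (.seq (.setVar marked (var best)) (.setVar mover (.lit 0))))
    (.seq (place (var marked)) nextMover)

/-- Performs one iteration of the while-loop of the algorithm if the player `mover` can improve,
and continues with the next player if not. -/
def improveStep : RamProg :=
  .ite (entry (var marked)) (.seq (remove (var marked)) (.seq findBest reinsert)) nextMover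

/-- Performs iterations of the while-loop of the algorithm until no player from `mover` on can
improve. -/
def repair : RamProg := .loop (.sub (.get sizes (.lit 0)) (var mover)) improveStep

/-- One iteration of the for-loop of the algorithm, in which `player` gets another unit, together
with all the iterations of the while-loop that follow. -/
def addStep : RamProg :=
  .seq (.setVar mover (var player)) <|
  .seq findBest <|
  .seq (place (var best)) <|
  .seq (.setVar marked (var best)) <|
  .seq (.setVar mover (.lit 0)) repair

/-- The algorithm, where the players get their units one player after the other. -/
def computeNash : RamProg :=
  .forLoop player (.get sizes (.lit 0)) <|
  .forLoop unitCount (.get demands (var player)) addStep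

/-- A bound for the number of steps of `addStep`, analogous to `checkBound`. -/
def addBound {A : Type*} [CommSemiring A] (n m : A) (d : ℕ) : A :=
  findBound m d + (n ^ 2 * m * d ^ 3 * (n + 1) + n) * (findBound m d + 15) + 12

/-- A bound for the number of steps of `computeNash`, analogous to `checkBound`. -/
def nashBound {A : Type*} [CommSemiring A] (n m : A) (d : ℕ) : A :=
  n * (d * (addBound n m d + 3) + 6) + 3

section

variable {n m : ℕ} {G : PolymatroidGame (Fin n) (Fin m)} {μ ν : RamMem} {i : Fin n}
  {r t : Fin m} {z : Fin m → ℕ} {s s' : AlgState (Fin n) (Fin m)} {e : Fin n → ℕ}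
  {J T k : ℕ}

theorem findBound_mono {m m' d d' : ℕ} (hm : m ≤ m') (hd : d ≤ d') :
    findBound m d ≤ findBound m' d' := by
  simp only [findBound, checkBound, Nat.cast_id]
  gcongr
  exact one_le_two

theorem nashBound_mono {n m d n' m' d' : ℕ} (hn : n ≤ n') (hm : m ≤ m') (hd : d ≤ d') :
    nashBound n m d ≤ nashBound n' m' d' := by
  have hfind := findBound_mono hm hd
  simp only [nashBound, addBound, Nat.cast_id]
  gcongr

theorem load_update_lt_sum_demand (hF : G.Feasible s) (hz : s.profile i = addUnit z r)
    (q : Fin m) : load (Function.update s.profile i z) q < ∑ j, G.demand j := by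
  have hsum : ∑ r, z r + 1 = s.demand i := by rw [← univ_sum_addUnit, ← hz, (hF.base i).2]
  refine load_lt_sum_demand (i := i) (fun j => ?_) ?_ q
  · obtain rfl | hj := eq_or_ne j i
    · rw [Function.update_self]
      exact (Nat.le_of_succ_le hsum.le).trans (hF.le j)
    · rw [Function.update_of_ne hj, (hF.base j).2]
      exact hF.le j
  · rw [Function.update_self]
    exact hsum.le.trans (hF.le i)

/-- The while-loop of the algorithm: the latest unit is on `r`, and no player below `J` can
improve. -/
structure Repairing (G : PolymatroidGame (Fin n) (Fin m)) (μ : RamMem)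
    (s : AlgState (Fin n) (Fin m)) (r : Fin m) (J : ℕ) : Prop where
  represents : Represents G μ s.profile
  marked : G.Marked s r
  val_marked : μ RamProg.marked 0 = r
  val_mover : μ mover 0 = J
  le : J ≤ n
  not_canImprove : ∀ j : Fin n, j < J → ¬ G.CanImprove s.demand s.profile j

theorem Repairing.succ (h : Repairing G μ s r i) (hi : ¬ G.CanImprove s.demand s.profile i)
    (hν : ∀ a ∈ [sizes, demands, strategies, loads, RamProg.marked], ν a = μ a)
    (hmover : ν mover 0 = i + 1) : Repairing G ν s r (i + 1) where
  represents := h.represents.congr fun a ha => hν a (List.mem_append_left [RamProg.marked] ha)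
  marked := h.marked
  val_marked := by rw [hν _ (by decide), h.val_marked]
  val_mover := hmover
  le := i.2
  not_canImprove j hj := by
    obtain hj | hj := Nat.lt_succ_iff_lt_or_eq.1 hj
    · exact h.not_canImprove j hj
    · exact Fin.ext hj ▸ hi

/-- The while-loop proceeds either to the next player or to the next iteration. -/
def Proceeds (G : PolymatroidGame (Fin n) (Fin m)) (s : AlgState (Fin n) (Fin m)) (r : Fin m)
    (J : ℕ) (ν : RamMem) : Prop :=
  Repairing G ν s r (J + 1) ∨
    ∃ s' t, G.AlgStep s s' ∧ s'.demand = s.demand ∧ Repairing G ν s' t 0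

theorem reinsert_halts (h : G.Marked s r) (hF : G.Feasible s) (hz : s.profile i = addUnit z r)
    (hrep : Represents G μ (Function.update s.profile i z)) (hi : μ mover 0 = i)
    (hr : μ marked 0 = r) (ht : μ best 0 = t)
    (hcheap : G.IsCheapestUnit i (s.demand i) (others s.profile i) z t)
    (hopt : ∀ j : Fin n, (j : ℕ) < i → ¬ G.CanImprove s.demand s.profile j) :
    reinsert.HaltsWithin G μ 8 (Proceeds G s r i) := by
  have hload := load_update_lt_sum_demand hF hz
  have hval {b : ℕ} {q : Fin m} (hb : μ b 0 = q) :
      ((increase (var b)).val G μ : ℤ) = G.marginalCost i (others s.profile i) z q := by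
    rw [hrep.val_increase hi hb, others_update_self, Function.update_self]
  have hcomp : (RamExpr.sub (increase (var marked)) (increase (var best))).val G μ = 0 ↔
      G.marginalCost i (others s.profile i) z r ≤ G.marginalCost i (others s.profile i) z t := by
    rw [← hval hr, ← hval ht, Nat.cast_le, ← Nat.sub_eq_zero_iff_le]
    rfl
  refine .ite ⟨hrep.increase_safe hr (hload r), hrep.increase_safe ht (hload t)⟩
    (fun hgt => ?_) fun hle => ?_
  · obtain ⟨hstep, hmarked⟩ := h.algStep_move hz hcheap (not_le.1 (mt hcomp.2 hgt))
    refine (place_halts hrep hi ht (by decide)).seq (b' := 3) fun ν hfν hν =>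
      .assign_seq trivial trivial (.assign trivial trivial
        (.inr ⟨_, t, hstep, rfl, ?_, hmarked, ?_, ?_, Nat.zero_le _, ?_⟩))
    · rw [Function.update_idem, Function.update_self] at hν
      exact hν.congr (by simp +decide)
    · simp +decide [RamExpr.val, hfν, ht]
    · simp +decide [RamExpr.val]
    · exact fun j hj => absurd hj (Nat.not_lt_zero _)
  · refine (place_halts hrep hi hr (by decide)).seq (b' := 3) fun ν hfν hν => ?_
    have hcan : ¬ G.CanImprove s.demand s.profile i := by
      intro hcan
      obtain ⟨z', q, hz', hq, hlt⟩ := h.exists_of_canImprove hF hcan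
      obtain rfl := addUnit_injective r (hz.symm.trans hz')
      exact ((hcomp.1 hle).trans (hcheap.2 q hq)).not_gt hlt
    have hold : Repairing G ν s r i :=
      { represents := by rwa [Function.update_idem, Function.update_self, ← hz,
          Function.update_eq_self] at hν
        marked := h
        val_marked := by rw [hfν _ (by decide), hr]
        val_mover := by rw [hfν _ (by decide), hi]
        le := i.2.le
        not_canImprove := hopt }
    exact .assign trivial ⟨trivial, trivial⟩ (.inl (hold.succ hcan (by simp +decide)
      (by simp [RamExpr.val, hold.val_mover])))

theorem improveStep_halts (hF : G.Feasible s) (h : Repairing G μ s r i) :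
    improveStep.HaltsWithin G μ (findBound m G.maxDemand + 14) (Proceeds G s r i) := by
  have hdi : G.demand i ≤ G.maxDemand := Finset.le_sup (Finset.mem_univ i)
  refine .ite (entry_safe trivial) (fun hpos => ?_) fun hzero => ?_
  · rw [h.represents.val_entry h.val_mover h.val_marked] at hpos
    obtain ⟨z, hz⟩ := exists_eq_addUnit (Nat.pos_of_ne_zero hpos)
    have hbase := hz ▸ hF.base i
    refine .mono (b := 3 + (findBound m G.maxDemand + 8 + 1) + 1) ?_ (by omega) fun _ _ hν => hν
    refine (remove_halts h.represents h.val_mover h.val_marked (by decide) hz).seq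
      fun ν hfν hν => ?_
    have hfind := findBest_halts hν (d := s.demand i) (by rw [hfν _ (by decide), h.val_mover])
      (load_update_lt_sum_demand hF hz)
      (by rw [Function.update_self, ← univ_sum_addUnit, hbase.2]) (hF.le i)
      ⟨r, by rwa [Function.update_self]⟩
    rw [others_update_self, Function.update_self] at hfind
    refine (hfind.mono (findBound_mono le_rfl hdi) fun _ _ hξ => hξ).seq
      fun ξ hfξ ⟨hξ, t, ht, hcheap⟩ => ?_
    refine reinsert_halts h.marked hF hz hξ ?_ ?_ ht hcheap h.not_canImprove
    · rw [hfξ _ (by decide), hfν _ (by decide), h.val_mover]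
    · rw [hfξ _ (by decide), hfν _ (by decide), h.val_marked]
  · refine .assign trivial ⟨trivial, trivial⟩ (.inl (h.succ (fun hcan => ?_) (by simp +decide)
      (by simp [RamExpr.val, h.val_mover])))
    obtain ⟨z, -, hz, -⟩ := h.marked.exists_of_canImprove hF hcan
    rw [h.represents.val_entry h.val_mover h.val_marked, hz, addUnit_self] at hzero
    exact Nat.succ_ne_zero _ hzero

/-- The algorithm is at the end of an iteration of the for-loop, with the demands `e`. -/
def Settled (G : PolymatroidGame (Fin n) (Fin m)) (μ : RamMem) (e : Fin n → ℕ) : Prop :=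
  ∃ T s, G.AlgRun T s ∧ s.demand = e ∧ Represents G μ s.profile ∧
    ∀ j, ¬ G.CanImprove s.demand s.profile j

theorem Settled.congr (h : Settled G μ e)
    (hν : ∀ a ∈ [sizes, demands, strategies, loads], ν a = μ a) : Settled G ν e := by
  obtain ⟨T, s, hrun, hdem, hrep, hopt⟩ := h
  exact ⟨T, s, hrun, hdem, hrep.congr hν, hopt⟩

/-- The program `repair` has at most `k` iterations left: at most `n ^ 2 * m * G.maxDemand ^ 3`
times an iteration of the algorithm starts the list of the players again, and all other iterations
of `repair` reach the next player. -/
def RepairingWithin (G : PolymatroidGame (Fin n) (Fin m)) (e : Fin n → ℕ) (k : ℕ) (μ : RamMem) :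
    Prop :=
  ∃ T s r J, G.AlgRun T s ∧ s.demand = e ∧ Repairing G μ s r J ∧
    n ^ 2 * m * G.maxDemand ^ 3 * (n + 1) + n ≤ k + T * (n + 1) + J

theorem RepairingWithin.next (hrun : G.AlgRun T s) (hdem : s.demand = e) (hJ : J < n)
    (hk : n ^ 2 * m * G.maxDemand ^ 3 * (n + 1) + n ≤ k + T * (n + 1) + J)
    (hν : Proceeds G s r J ν) : ∃ k' < k, RepairingWithin G e k' ν := by
  have hT : T * (n + 1) ≤ n ^ 2 * m * G.maxDemand ^ 3 * (n + 1) := by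
    simpa using Nat.mul_le_mul_right (n + 1) hrun.le_sq_mul_mul_cube
  refine ⟨k - 1, by omega, ?_⟩
  obtain hν | ⟨s', t, hstep, hdem', hν⟩ := hν
  · exact ⟨T, s, r, J + 1, hrun, hdem, hν, by omega⟩
  · exact ⟨T + 1, s', t, 0, hrun.step hstep, hdem'.trans hdem, hν, by rw [Nat.add_mul T]; omega⟩

theorem repair_halts (h : RepairingWithin G e k μ) :
    repair.HaltsWithin G μ (k * (findBound m G.maxDemand + 15) + 1) (Settled G · e) := by
  refine .loop (RepairingWithin G e) (fun _ _ _ => ⟨trivial, trivial⟩) ?_ h ?_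
  · rintro k ν ⟨T, s, r, J, hrun, hdem, hν, hk⟩ hne
    have hJ : J < n := by
      simp only [RamExpr.val, hν.represents.players, hν.val_mover] at hne
      omega
    exact (improveStep_halts (i := ⟨J, hJ⟩) hrun.inv.1 hν).mono le_rfl
      fun ξ _ hξ => RepairingWithin.next hrun hdem hJ hk hξ
  · rintro k ν ⟨T, s, r, J, hrun, hdem, hν, -⟩ hzero
    simp only [RamExpr.val, hν.represents.players, hν.val_mover] at hzero
    exact ⟨T, s, hrun, hdem, hν.represents, fun j => hν.not_canImprove j (by omega)⟩

theorem addStep_halts (h : Settled G μ e) (hi : μ player 0 = i) (he : e i < G.demand i) :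
    addStep.HaltsWithin G μ (addBound n m G.maxDemand)
      (Settled G · (Function.update e i (e i + 1))) := by
  obtain ⟨T, s, hrun, rfl, hrep, hopt⟩ := h
  have hF := hrun.inv.1
  have hbase := hF.base i
  have hdi : G.demand i ≤ G.maxDemand := Finset.le_sup (Finset.mem_univ i)
  have hsum (j : Fin n) : ∑ r, s.profile j r = s.demand j := (hF.base j).2
  refine .mono (b := findBound m G.maxDemand + (3 + (((n ^ 2 * m * G.maxDemand ^ 3 * (n + 1) + n) *
    (findBound m G.maxDemand + 15) + 1) + 2 + 2) + 1) + 1 + 2) ?_ ?_ fun _ _ hν => hν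
  · refine .assign_seq trivial trivial ?_
    have hfind := findBest_halts (hrep.congr (ν := μ.write mover 0 (μ player 0)) (by simp +decide))
      (i := i) (d := s.demand i + 1) (by simp [hi])
      (load_lt_sum_demand (i := i) (fun j => (hsum j).trans_le (hF.le j)) ((hsum i).trans_lt he))
      (by rw [hsum]) he ((G.f i).exists_addUnit_mem_base hbase (he.trans_le (G.demand_le i)))
    refine (hfind.mono (findBound_mono le_rfl hdi) fun _ _ hν => hν).seq
      fun ν hfν ⟨hν, t, ht, hcheap⟩ => ?_
    obtain ⟨hstep, hmarked⟩ := algStep_insert hF hopt he hcheap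
    refine (place_halts hν (i := i) (by simp +decide [hfν, hi]) ht (by decide)).seq
      fun ξ hfξ hξ => .assign_seq trivial trivial (.assign_seq trivial trivial
        (repair_halts ⟨T + 1, _, t, 0, hrun.step hstep, rfl, ?_, by omega⟩))
    exact
      { represents := hξ.congr (by simp +decide)
        marked := hmarked
        val_marked := by simp +decide [RamExpr.val, hfξ, ht]
        val_mover := by simp [RamExpr.val]
        le := Nat.zero_le _
        not_canImprove := fun j hj => absurd hj (Nat.not_lt_zero _) }
  · simp only [addBound, Nat.cast_id]
    omega

/-- The demands after the players below `I` have got all their units, and player `I` has got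
`K` units. -/
def partialDemand (G : PolymatroidGame (Fin n) (Fin m)) (I K : ℕ) (j : Fin n) : ℕ :=
  if (j : ℕ) < I then G.demand j else if (j : ℕ) = I then K else 0

theorem partialDemand_self (i : Fin n) (K : ℕ) : partialDemand G i K i = K := by
  simp [partialDemand]

theorem partialDemand_succ (i : Fin n) (K : ℕ) :
    partialDemand G i (K + 1) = Function.update (partialDemand G i K) i (K + 1) := by
  ext j
  obtain rfl | hj := eq_or_ne j i
  · simp [partialDemand]
  · simp [partialDemand, hj, Fin.val_ne_of_ne hj]

theorem partialDemand_next (i : Fin n) :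
    partialDemand G (i + 1) 0 = partialDemand G i (G.demand i) := by
  ext j
  obtain rfl | hj := eq_or_ne j i
  · simp [partialDemand]
  · have hlt : (j : ℕ) < i + 1 ↔ (j : ℕ) < i := Nat.lt_succ_iff_lt_or_eq.trans
      (or_iff_left (Fin.val_ne_of_ne hj))
    simp only [partialDemand, hlt, if_neg (Fin.val_ne_of_ne hj), ite_self]

theorem settled_ramInput : Settled G (ramInput G) (partialDemand G 0 0) := by
  refine ⟨0, AlgState.init _ _, .start, ?_, ?_, not_canImprove_init⟩
  · ext j
    simp [AlgState.init, partialDemand]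
  · constructor <;> simp [ramInput, AlgState.init, load]

theorem Settled.isPureNash (h : Settled G μ (partialDemand G n 0)) :
    G.IsPureNash (ramOutput n m μ) := by
  obtain ⟨T, s, hrun, hdem, hrep, hopt⟩ := h
  have hF := hrun.inv.1
  rw [show ramOutput n m μ = s.profile from funext₂ hrep.profile]
  refine hF.isPureNash hopt ?_
  rw [← hF.sum, hdem]
  simp [partialDemand]

theorem computeNash_halts (G : PolymatroidGame (Fin n) (Fin m)) :
    computeNash.HaltsWithin G (ramInput G) (nashBound n m G.maxDemand) fun ν =>
      G.IsPureNash (ramOutput n m ν) := by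
  refine .forLoop (fun I ν => Settled G ν (partialDemand G I 0)) (by decide)
    (fun ν hν => ⟨trivial, by simp +decide [RamExpr.val, hν, ramInput]⟩)
    (settled_ramInput.congr (by simp +decide))
    (fun I hI ν hfν hν hI0 => ?_) fun ν hν => hν.isPureNash
  have hdi : G.demand ⟨I, hI⟩ ≤ G.maxDemand := Finset.le_sup (Finset.mem_univ _)
  refine .mono (Q := fun ξ => Settled G ξ (partialDemand G I (G.demand ⟨I, hI⟩)))
    (b := G.demand ⟨I, hI⟩ * (addBound n m G.maxDemand + 3) + 3) ?_
    (by rw [Nat.cast_id]; gcongr) fun ξ _ hξ => ?_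
  · refine .forLoop (fun K ξ => Settled G ξ (partialDemand G I K)) (by decide)
      (fun ξ hξ => ⟨trivial, ?_⟩) (hI0.congr (by simp +decide))
      (fun K hK ξ hfξ _ hK0 => ?_) fun ξ hξ => hξ
    · simp +decide [RamExpr.val, hξ, hν, hfν, ramInput, hI]
    · have hKi := partialDemand_self (G := G) ⟨I, hI⟩ K
      refine (addStep_halts (i := ⟨I, hI⟩) hK0 (by rw [hfξ _ (by decide), hν])
        (hKi.trans_lt hK)).mono le_rfl fun ρ _ hρ => ?_
      rw [hKi, ← partialDemand_succ ⟨I, hI⟩] at hρ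
      exact hρ.congr (by simp +decide)
  · rw [← partialDemand_next ⟨I, hI⟩] at hξ
    exact hξ.congr (by simp +decide)

theorem additive_computeNash : computeNash.Additive := by
  simp [Additive, RamExpr.Additive, computeNash, addStep, improveStep, reinsert, nextMover,
    repair, findBest, updateBest, tryUnit, checkIndep,
    testSubset, decodeStep, forLoop, place, remove, entry]

theorem bounded_ramInput : (ramInput G).Bounded (n + m + G.maxBits) := by
  have hsize : n + m < 2 ^ (n + m + G.maxBits) :=
    Nat.lt_two_pow_self.trans_le (Nat.pow_le_pow_right two_pos (Nat.le_add_right _ _))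
  have hdemand (i : Fin n) : G.demand i < 2 ^ (n + m + G.maxBits) :=
    calc
      G.demand i ≤ (G.f i).rank Finset.univ := G.demand_le i
      _ = rankOracle G i fun _ => 1 := by simp [rankOracle]
      _ < 2 ^ G.maxBits := rankOracle_lt G _ _
      _ ≤ _ := Nat.pow_le_pow_right two_pos (Nat.le_add_left _ _)
  intro a j
  rw [ramInput]
  split_ifs
  exacts [by omega, by omega, by positivity, hdemand _, by positivity, by positivity]

theorem exists_polynomial (δ : ℕ) : ∃ P : Polynomial ℕ, ∀ n m : ℕ, 0 < n →
    ∀ G : PolymatroidGame (Fin n) (Fin m), G.maxDemand ≤ δ →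
      ∃ (t : ℕ) (μ : RamMem), RamExec G computeNash (ramInput G) t μ ∧
        t ≤ P.eval (n + m + G.maxBits) ∧ G.IsPureNash (ramOutput n m μ) := by
  generalize hW : computeNash.weight = W
  let S : Polynomial ℕ := nashBound .X .X δ
  have hS (N : ℕ) : S.eval N = nashBound N N δ := by
    simp [S, nashBound, addBound, findBound, checkBound]
  refine ⟨S * (W * (1 + .X + (.X + S * W) * W) + 1), fun n m hn G hG => ?_⟩
  obtain ⟨s, hs, μ, hrun, hnash⟩ := computeNash_halts G
  obtain ⟨t, ht, hexec⟩ := hrun.exists_exec additive_computeNash hW.le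
    (Nat.le_add_left _ _) (by omega) bounded_ramInput le_rfl
  refine ⟨t, μ, hexec, ht.trans ?_, hnash⟩
  generalize hN : n + m + G.maxBits = N
  have hsS : s ≤ S.eval N := by
    rw [hS]
    exact hs.trans (nashBound_mono (by omega) (by omega) hG)
  have hmN : m ≤ N := by omega
  simp only [Polynomial.eval_mul, Polynomial.eval_add, Polynomial.eval_X, Polynomial.eval_one,
    Polynomial.eval_natCast, Nat.cast_id]
  gcongr

end

end RamProg

theorem mainTheorem2 :
    (∀ (N : Type*) (R : Type*) [Fintype N] [DecidableEq N] [Nonempty N]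
      [Fintype R] [DecidableEq R] [Nonempty R] (G : PolymatroidGame N R),
      (∀ (T : ℕ) (s : PolymatroidGame.AlgState N R), G.AlgRun T s →
        T ≤ Fintype.card N ^ (G.maxDemand + 1) * Fintype.card R ^ G.maxDemand *
          G.maxDemand ^ (G.maxDemand + 1)) ∧
      (∀ (T : ℕ) (s : PolymatroidGame.AlgState N R), G.AlgRun T s →
        (G.AlgReturns s ∧ G.IsPureNash s.profile) ∨
          (¬ G.AlgReturns s ∧ ∃ s', G.AlgStep s s'))) ∧
    (∃ prog : RamProg, ∀ δ : ℕ, ∃ P : Polynomial ℕ,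
      ∀ (n m : ℕ), 0 < n → 0 < m → ∀ G : PolymatroidGame (Fin n) (Fin m), G.maxDemand ≤ δ →
        ∃ (t : ℕ) (μ : RamMem), RamExec G prog (ramInput G) t μ ∧
          t ≤ P.eval (n + m + G.maxBits) ∧
          G.IsPureNash (ramOutput n m μ)) :=
  ⟨fun _ _ _ _ _ _ _ _ _ => ⟨fun _ _ h => h.le, fun _ _ h => h.progress⟩,
    RamProg.computeNash, fun δ =>
      (RamProg.exists_polynomial δ).imp fun _ h n m hn _ => h n m hn⟩
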